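/- **Setting.** Let $X\subset\mathbb{C}^m\times\mathbb{C}^n$ be the zero set of a system of polynomials in $(z,x)$ (irreducibility of $X$ is not needed), with projection $\pi(z,x)=z$ and fibers $\pi^{-1}(z)=\{x : (z,x)\in X\}$, and let $d>0$ be its generic root count: outside a proper algebraic subset of $\mathbb{C}^m$ the fiber has exactly $d$ points. The *discriminant* is the set of $z$ whose fiber does not consist of exactly $d$ points. Let $F(x;z)=(f_1,\dots,f_n)$ be a square system of rational functions that locally defines $X$: at a dense set of points of $X$, $F$ is defined, $\partial_xF$ is invertible, and $X$ coincides locally with the zero set of $F$. Let $\mathcal{G}$ be a finite connected multigraph with vertices placed in $\mathbb{C}^m$ and with each edge $e=(u,v)$ decorated by a continuous path $p_e$ from $u$ to $v$, all vertices and paths avoiding the discriminant. Let $z_0$ be a vertex and $x_0\in\pi^{-1}(z_0)$. **Krawczyk test.** On $\mathbb{C}^n$ put $\|v\|=\max_i\max(|\mathrm{Re}\,v_i|,|\mathrm{Im}\,v_i|)$ and $B=\{\|v\|\le 1\}$. For a set $C$ of centers, $r>0$, an invertible matrix $A$ and $\rho\in(0,1)$, the test for $F(\cdot;z)$ with $z$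 ranging over a set $Z$ is passed if, for interval enclosures $\square F$ of $F$ on $C\times Z$ and $\square JF$ of $\partial_xF$ on $(C+rB)\times Z$ ($F$ being defined there), the set $K=-\frac1rA\,\square F+(I_n-A\,\square JF)B$ satisfies $\|K\|<\rho$. A point $x$ that passes (with $C=\{x\}$, $Z=\{z\}$) is a $\rho$-approximate solution with certification radius $r$; its associated solution is the zero of $F(\cdot;z)$ in $x+rB$. **Tracking.** Fix $\rho\in(0,\frac12]$, $\tau\in(\frac12,1)$, $g\in(0,1-\tau)$, $\delta_{inc}>1$, $\delta_{dec}\in(0,1)$. *Refine* takes a system $f=F(\cdot;z)$ and a $\tau$-approximate solution $x$ with certification radius $r$ and matrix $A$. Starting with $\tilde r=r$, $\tilde A=A$, until $(x,\tilde r,\tilde A)$ passes the test with constant $\rho$ it halves $\tilde r$ if $\|Af(x)\|\le g\rho\tilde r$ and otherwise replaces $x$ by $x-Af(x)$, in both cases then setting $\tilde A=Jf(x)^{-1}$; after that it may double $\tilde r$ as long as $2\tilde r\le1$ and the test with $\rho$ is passed at radius $2\tilde r$. *CertifiedTrack* along a path $p$ starts at $t=0$ with a $\rho$-approximate solution $x$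 of $F(\cdot;p(0))$, constants $h,r\in(0,1)$ and $A=\partial_xF(x;p(0))^{-1}$. While $t<1$ it refines $(x,r,A)$ for $F(\cdot;p(t))$; multiplies $h$ by $\delta_{inc}$ and then by $\delta_{dec}$ repeatedly, until the test with constants $r,A,\tau$ is passed with $Z=p([t,t'])$, $t'=\min(t+h,1)$, and with $C$ a box containing $X([t,t'])$, where the predictor $X(\cdot)$ is any map with $X(t)=x$; and sets $t=t'$, $x=X(t')$. At $t=1$ it refines once more and returns a $\rho$-approximate solution of $F(\cdot;p(1))$. **Algorithm.** Initially $x_0$ over $z_0$ is the only known solution. As long as $\mathcal{G}$ is not saturated, choose an edge that is not saturated, transport all known solutions at one of its ends to the other end by CertifiedTrack, and record at the edge the pairs of associated solutions. An edge $(u,v)$ is saturated if each known solution at either end is paired with a known solution at the other end; $\mathcal{G}$ is saturated if all its edges are. Then choose a spanning tree $\mathcal{T}$ and output $$S=\{\phi_{v}^{-1}\circ\gamma_e\circ\phi_{u} : e=(u,v)\notin\mathcal{T}\},$$ where $\gamma_e$ is the recorded correspondence of $e$ and $\phi_{w}$ is the composition of the correspondences along the path in $\mathcal{T}$ from $z_0$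 to $w$. A loop $\ell$ at $z_0$ *induces* a permutation $\sigma$ of a set $K\subset\pi^{-1}(z_0)$ if for each $a\in K$ there is a continuous lift of $\ell$ to $X$ starting at $(z_0,a)$, and each such lift ends at $(z_0,\sigma(a))$. $\mathrm{Mon}_\pi$ is the group of permutations of $\pi^{-1}(z_0)$ generated by those induced by loops at $z_0$ avoiding the discriminant. $\mathrm{Mon}_{\mathcal{G},z_0}$, acting on $K$, is generated by the permutations of $K$ induced by the loops of all closed walks in $\mathcal{G}$ at $z_0$ (edges may be traversed in both directions). **Theorem.** Suppose the algorithm terminates with $\mathcal{G}$ saturated, all Krawczyk tests required above being passed, and let $K$ be the set of the $k$ known solutions at $z_0$. Then all known solutions lie in the fibers of $\pi$; the recorded edge correspondences are bijections between the sets of known solutions at the ends of the edges; and every closed walk in $\mathcal{G}$ at $z_0$ induces a permutation of $K$. Moreover, for every choice of the spanning tree: 1. $S$ consists of permutations of $K$ induced by loops in parameter space at $z_0$ that avoid the discriminant. 2. The action of $\langle S\rangle$ on $K$ is transitive and coincides with that of $\mathrm{Mon}_{\mathcal{G},z_0}$. 3. If $k=d$, then $K=\pi^{-1}(z_0)$ and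 $\langle S\rangle=\mathrm{Mon}_{\mathcal{G},z_0}\subseteq\mathrm{Mon}_\pi$ as groups of permutations of $\pi^{-1}(z_0)$. -/

import Mathlib

open Topology

noncomputable section

namespace CertMon

/-! ## Parametrized systems and their solution varieties -/

/-- The parameter space `ℂ^m` and the space of unknowns `ℂ^n`. -/
abbrev CVec (n : ℕ) : Type := Fin n → ℂ

/-- Polynomials in the parameters `z` (left variables) and the unknowns `x` (right variables). -/
abbrev ParamPoly (m n : ℕ) : Type := MvPolynomial (Fin m ⊕ Fin n) ℂ

/-- The value `f(x; z)` of a parametrized polynomial. -/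
def evalAt {m n : ℕ} (f : ParamPoly m n) (z : CVec m) (x : CVec n) : ℂ :=
  MvPolynomial.eval (Sum.elim z x) f

/-- The set `X = {(z, x) | f(x; z) = 0 for all f in the given system}` of problem-solution pairs.
The system need not be square. -/
def solutionVariety {m n : ℕ} (P : Set (ParamPoly m n)) : Set (CVec m × CVec n) :=
  {q | ∀ f ∈ P, evalAt f q.1 q.2 = 0}

/-- The fiber `π⁻¹(z)`, as a set of solutions `x`. -/
def fiber {m n : ℕ} (X : Set (CVec m × CVec n)) (z : CVec m) : Set (CVec n) :=
  {x | (z, x) ∈ X}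

/-- `d > 0` is the generic root count: outside a proper algebraic subset of the parameter space,
the fiber consists of exactly `d` points. -/
def IsGenericRootCount {m n : ℕ} (X : Set (CVec m × CVec n)) (d : ℕ) : Prop :=
  0 < d ∧ ∃ h : MvPolynomial (Fin m) ℂ, h ≠ 0 ∧
    ∀ z : CVec m, MvPolynomial.eval z h ≠ 0 → (fiber X z).encard = d

/-- The discriminant: the parameters whose fiber does not consist of exactly `d` distinct
(hence isolated) solutions. -/
def discriminant {m n : ℕ} (X : Set (CVec m × CVec n)) (d : ℕ) : Set (CVec m) :=
  {z | (fiber X z).encard ≠ d}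

/-- A square system `f₁(x; z), …, fₙ(x; z)` of rational functions, each given as a fraction of
polynomials. Polynomial systems have all denominators equal to `1`. -/
structure SquareSystem (m n : ℕ) where
  num : Fin n → ParamPoly m n
  den : Fin n → ParamPoly m n
  den_ne_zero : ∀ i, den i ≠ 0

namespace SquareSystem

variable {m n : ℕ}

/-- No denominator vanishes at `(z, x)`. -/
def DefinedAt (F : SquareSystem m n) (z : CVec m) (x : CVec n) : Prop :=
  ∀ i, evalAt (F.den i) z x ≠ 0

/-- `F(x; z)`; meaningful where `F` is defined. -/
def eval (F : SquareSystem m n) (z : CVec m) (x : CVec n) : CVec n :=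
  fun i => evalAt (F.num i) z x / evalAt (F.den i) z x

/-- The Jacobian matrix `∂ₓF(x; z)`, by the quotient rule. -/
def jac (F : SquareSystem m n) (z : CVec m) (x : CVec n) : Matrix (Fin n) (Fin n) ℂ :=
  Matrix.of fun i j =>
    (evalAt (MvPolynomial.pderiv (Sum.inr j) (F.num i)) z x * evalAt (F.den i) z x -
      evalAt (F.num i) z x * evalAt (MvPolynomial.pderiv (Sum.inr j) (F.den i)) z x) /
      evalAt (F.den i) z x ^ 2

/-- `(z, x) ∈ X` is a regular sample for `F`: the system is defined there, its Jacobian with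
respect to the unknowns has full rank, and its zero set coincides with `X` near `(z, x)`. -/
def IsRegularSample (F : SquareSystem m n) (X : Set (CVec m × CVec n))
    (q : CVec m × CVec n) : Prop :=
  q ∈ X ∧ F.DefinedAt q.1 q.2 ∧ IsUnit (F.jac q.1 q.2).det ∧
    ∀ᶠ q' in 𝓝 q, (q' ∈ X ↔ F.eval q'.1 q'.2 = 0)

/-- `F` locally defines `X`: the generic point of `X` is a regular sample, that is, the regular
samples are dense in `X`. -/
def LocallyDefines (F : SquareSystem m n) (X : Set (CVec m × CVec n)) : Prop :=
  X ⊆ closure {q | F.IsRegularSample X q}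

end SquareSystem

/-! ## Complex intervals and the Krawczyk test -/

/-- A complex interval `Re(I) + i Im(I)`. -/
structure CInterval where
  re : NonemptyInterval ℝ
  im : NonemptyInterval ℝ

/-- The rectangle of all complex numbers in a complex interval. -/
def CInterval.toSet (I : CInterval) : Set ℂ :=
  {w | w.re ∈ I.re ∧ w.im ∈ I.im}

/-- The box of all vectors in an interval vector. -/
def boxSet {n : ℕ} (I : Fin n → CInterval) : Set (CVec n) :=
  {v | ∀ i, v i ∈ (I i).toSet}

/-- All matrices in an interval matrix. -/
def matrixBoxSet {n : ℕ} (I : Fin n → Fin n → CInterval) : Set (Matrix (Fin n) (Fin n) ℂ) :=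
  {M | ∀ i j, M i j ∈ (I i j).toSet}

/-- The real `∞`-norm `max_i max (|Re vᵢ|, |Im vᵢ|)` on `ℂ^n`. -/
def boxNorm {n : ℕ} (v : CVec n) : ℝ :=
  ‖(fun i => max |(v i).re| |(v i).im| : Fin n → ℝ)‖

/-- `C + rB` with `B = ([-1,1] + i[-1,1])^n`. -/
def thicken {n : ℕ} (C : Set (CVec n)) (r : ℝ) : Set (CVec n) :=
  {y | ∃ x ∈ C, boxNorm (y - x) ≤ r}

/-- The Krawczyk test for the system `F(·; z)` with parameters `z` ranging over `Z`, and with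
center ranging over `C`, answers `true`: for some interval enclosures `FI` of the values of `F`
on `C` and `JI` of the Jacobian on `C + rB` (in particular `F` is defined there), the set
`K = -(1/r) A FI + (Id - A JI) B` satisfies `‖K‖ < ρ`. Evaluating `K` by interval operations can
only enlarge it, so that a positive answer so obtained is also a positive answer in this sense. -/
def KrawczykTest {m n : ℕ} (F : SquareSystem m n) (Z : Set (CVec m)) (C : Set (CVec n))
    (r : ℝ) (A : Matrix (Fin n) (Fin n) ℂ) (ρ : ℝ) : Prop :=
  0 < r ∧ IsUnit A.det ∧
  ∃ (FI : Fin n → CInterval) (JI : Fin n → Fin n → CInterval),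
    (∀ z ∈ Z, ∀ x ∈ C, F.DefinedAt z x ∧ F.eval z x ∈ boxSet FI) ∧
    (∀ z ∈ Z, ∀ y ∈ thicken C r, F.DefinedAt z y ∧ F.jac z y ∈ matrixBoxSet JI) ∧
    ∀ f ∈ boxSet FI, ∀ M ∈ matrixBoxSet JI, ∀ b : CVec n, boxNorm b ≤ 1 →
      boxNorm (-((r : ℂ)⁻¹ • A.mulVec f) + (1 - A * M).mulVec b) < ρ

/-- `x` is a `ρ`-approximate solution of `F(·; z)` with certification radius `r` (and matrix `A`),
and `a` is its associated exact solution, the zero in `x + rB`. -/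
def Approximates {m n : ℕ} (F : SquareSystem m n) (z : CVec m) (ρ : ℝ)
    (x : CVec n) (r : ℝ) (A : Matrix (Fin n) (Fin n) ℂ) (a : CVec n) : Prop :=
  KrawczykTest F {z} {x} r A ρ ∧ F.eval z a = 0 ∧ boxNorm (a - x) ≤ r

/-! ## Certified path tracking

The algorithms are described by the relation between their inputs and the outputs of their
terminating executions. Enclosures may be arbitrarily conservative, so a negative answer of a
Krawczyk test carries no information: a loop that is guarded by a negative answer may run any
number of times, but it is left only after a positive answer. -/

/-- The constants of the tracking algorithm. -/
structure TrackConstants where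
  ρ : ℝ
  τ : ℝ
  g : ℝ
  δinc : ℝ
  δdec : ℝ
  ρ_mem : ρ ∈ Set.Ioc 0 (1 / 2)
  τ_mem : τ ∈ Set.Ioo (1 / 2) 1
  g_mem : g ∈ Set.Ioo 0 (1 - τ)
  δinc_gt : 1 < δinc
  δdec_mem : δdec ∈ Set.Ioo 0 1

/-- A point, a radius and a matrix. -/
structure Certificate (n : ℕ) where
  x : CVec n
  r : ℝ
  A : Matrix (Fin n) (Fin n) ℂ

/-- One pass through the first loop of `Refine`, where `A` is the input matrix: either the radius
is halved, or a quasi-Newton step is taken; then the matrix is recomputed. -/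
inductive RefineShrinkStep {m n : ℕ} (c : TrackConstants) (F : SquareSystem m n) (z : CVec m)
    (A : Matrix (Fin n) (Fin n) ℂ) : Certificate n → Certificate n → Prop
  | halve (s : Certificate n) (h : boxNorm (A.mulVec (F.eval z s.x)) ≤ c.g * c.ρ * s.r) :
      RefineShrinkStep c F z A s ⟨s.x, s.r / 2, (F.jac z s.x)⁻¹⟩
  | newton (s : Certificate n) (h : ¬ boxNorm (A.mulVec (F.eval z s.x)) ≤ c.g * c.ρ * s.r) :
      RefineShrinkStep c F z A s
        ⟨s.x - A.mulVec (F.eval z s.x), s.r, (F.jac z (s.x - A.mulVec (F.eval z s.x)))⁻¹⟩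

/-- One pass through the second loop of `Refine`: the radius is doubled. -/
inductive RefineGrowStep {m n : ℕ} (c : TrackConstants) (F : SquareSystem m n) (z : CVec m) :
    Certificate n → Certificate n → Prop
  | double (s : Certificate n) (h : 2 * s.r ≤ 1) (ht : KrawczykTest F {z} {s.x} (2 * s.r) s.A c.ρ) :
      RefineGrowStep c F z s ⟨s.x, 2 * s.r, s.A⟩

/-- `Refine`, applied to the system `F(·; z)` and to a `τ`-approximate solution `s.x` with
certification radius `s.r` and matrix `s.A`, may return `s'`. -/
def Refine {m n : ℕ} (c : TrackConstants) (F : SquareSystem m n) (z : CVec m)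
    (s s' : Certificate n) : Prop :=
  KrawczykTest F {z} {s.x} s.r s.A c.τ ∧
  ∃ s₁ : Certificate n, Relation.ReflTransGen (RefineShrinkStep c F z s.A) s s₁ ∧
    KrawczykTest F {z} {s₁.x} s₁.r s₁.A c.ρ ∧
    Relation.ReflTransGen (RefineGrowStep c F z) s₁ s'

/-- State of the outer loop of `CertifiedTrack`: time, step size, and current certificate. -/
structure TrackState (n : ℕ) where
  t : ℝ
  h : ℝ
  cert : Certificate n

/-- One pass through the outer loop of `CertifiedTrack`, for the homotopy
`H(x; t) = F(x; p(t))`: refine; multiply the step size by `δinc` and then `j` times by `δdec`,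
until the Krawczyk test succeeds with constant `τ`, for the homotopy over the time
interval from `t` to `t' = min(t + h, 1)` and an interval vector `XI` that encloses the values of
the predictor `Xp` there; proceed to time `t'` and to the predicted point `Xp(t')`.
The predictor is an arbitrary map with `Xp(t) = x`. -/
inductive TrackStep {m n : ℕ} (c : TrackConstants) (F : SquareSystem m n)
    {u v : CVec m} (p : Path u v) : TrackState n → TrackState n → Prop
  | step (s : TrackState n) (ht : s.t < 1)
      (s₁ : Certificate n) (href : Refine c F (p.extend s.t) s.cert s₁)
      (j : ℕ) (h' t' : ℝ) (hh' : h' = c.δdec ^ j * (c.δinc * s.h)) (ht' : t' = min (s.t + h') 1)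
      (Xp : ℝ → CVec n) (hXp : Xp s.t = s₁.x)
      (XI : Fin n → CInterval) (hXI : ∀ η ∈ Set.Icc s.t t', Xp η ∈ boxSet XI)
      (htest : KrawczykTest F (p.extend '' Set.Icc s.t t') (boxSet XI) s₁.r s₁.A c.τ) :
      TrackStep c F p s ⟨t', h', ⟨Xp t', s₁.r, s₁.A⟩⟩

/-- `CertifiedTrack` along the path `p`, started at the approximate solution `x` with initial
step size `h` and radius `r`, may terminate with the certificate `out`. -/
def CertifiedTrack {m n : ℕ} (c : TrackConstants) (F : SquareSystem m n)
    {u v : CVec m} (p : Path u v) (h r : ℝ) (x : CVec n) (out : Certificate n) : Prop :=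
  h ∈ Set.Ioo 0 1 ∧ r ∈ Set.Ioo 0 1 ∧
  ∃ s : TrackState n,
    Relation.ReflTransGen (TrackStep c F p) ⟨0, h, ⟨x, r, (F.jac u x)⁻¹⟩⟩ s ∧
    ¬ s.t < 1 ∧ Refine c F v s.cert out

/-- Some execution of `CertifiedTrack` along `p`, started at a `ρ`-approximate solution with
associated exact solution `a`, returns one with associated exact solution `b`. -/
def Tracked {m n : ℕ} (c : TrackConstants) (F : SquareSystem m n)
    {u v : CVec m} (p : Path u v) (a b : CVec n) : Prop :=
  ∃ (x : CVec n) (r₀ : ℝ) (A₀ : Matrix (Fin n) (Fin n) ℂ) (h r : ℝ) (out : Certificate n),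
    Approximates F u c.ρ x r₀ A₀ a ∧
    CertifiedTrack c F p h r x out ∧
    Approximates F v c.ρ out.x out.r out.A b

/-! ## Homotopy graphs -/

/-- A multigraph with vertices placed in the parameter space and edges decorated by paths. The
choice of an orientation of each edge is only used to orient its path. -/
structure HomotopyGraph (m : ℕ) (V E : Type*) where
  pos : V → CVec m
  src : E → V
  tgt : E → V
  path : ∀ e, Path (pos (src e)) (pos (tgt e))

namespace HomotopyGraph

variable {m n : ℕ} {V E : Type*}

/-- Walks, which may traverse edges in both directions. -/
inductive Walk (G : HomotopyGraph m V E) : V → V → Type _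
  | nil (v : V) : Walk G v v
  | fwd (e : E) {w : V} (W : Walk G (G.tgt e) w) : Walk G (G.src e) w
  | bwd (e : E) {w : V} (W : Walk G (G.src e) w) : Walk G (G.tgt e) w

namespace Walk

variable {G : HomotopyGraph m V E}

/-- The list of edges traversed by a walk. -/
def edges : {u v : V} → Walk G u v → List E
  | _, _, nil _ => []
  | _, _, fwd e W => e :: edges W
  | _, _, bwd e W => e :: edges W

/-- The list of vertices visited by a walk. -/
def verts : {u v : V} → Walk G u v → List V
  | _, _, nil v => [v]
  | _, _, fwd e W => G.src e :: verts W
  | _, _, bwd e W => G.tgt e :: verts W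

/-- The path in parameter space obtained by concatenating the paths of the edges. -/
def toPath : {u v : V} → Walk G u v → Path (G.pos u) (G.pos v)
  | _, _, nil v => Path.refl (G.pos v)
  | _, _, fwd e W => (G.path e).trans (toPath W)
  | _, _, bwd e W => (G.path e).symm.trans (toPath W)

/-- The composition of edge correspondences along a walk. -/
def transport {K : V → Set (CVec n)} (γ : ∀ e, K (G.src e) ≃ K (G.tgt e)) :
    {u v : V} → Walk G u v → (K u ≃ K v)
  | _, _, nil v => Equiv.refl (K v)
  | _, _, fwd e W => (γ e).trans (transport γ W)
  | _, _, bwd e W => (γ e).symm.trans (transport γ W)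

end Walk

/-- Any two vertices are joined by a walk. -/
def Connected (G : HomotopyGraph m V E) : Prop :=
  ∀ u v, Nonempty (G.Walk u v)

/-- All vertices and all paths avoid the discriminant. -/
def AvoidsDiscriminant (G : HomotopyGraph m V E) (X : Set (CVec m × CVec n)) (d : ℕ) : Prop :=
  (∀ v, G.pos v ∉ discriminant X d) ∧ ∀ e t, G.path e t ∉ discriminant X d

/-- The edges in `T` form a spanning tree: any two vertices are joined by a walk in `T`, and `T`
contains no circuit. -/
def IsSpanningTree (G : HomotopyGraph m V E) (T : Set E) : Prop :=
  (∀ u v, ∃ W : G.Walk u v, ∀ e ∈ W.edges, e ∈ T) ∧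
  ∀ (u : V) (W : G.Walk u u), (∀ e ∈ W.edges, e ∈ T) → W.edges.Nodup → W.edges = []

/-- A walk that is a path in `T` (no repeated vertices). -/
def IsPathIn (G : HomotopyGraph m V E) (T : Set E) {u v : V} (W : G.Walk u v) : Prop :=
  (∀ e ∈ W.edges, e ∈ T) ∧ W.verts.Nodup

/-- The output of `MonodromyGroup` for edge correspondences `γ` and a spanning tree `T`: the
permutations `φ_v⁻¹ ∘ γ_e ∘ φ_u` for the edges `e = (u, v)` not in `T`, where `φ_u`, `φ_v` are the
compositions of the correspondences along the paths in `T` from the base vertex to `u`, `v`. -/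
def monodromyGenerators (G : HomotopyGraph m V E) {K : V → Set (CVec n)}
    (γ : ∀ e, K (G.src e) ≃ K (G.tgt e)) (z₀ : V) (T : Set E) : Set (Equiv.Perm (K z₀)) :=
  {σ | ∃ e, e ∉ T ∧ ∃ (P : G.Walk z₀ (G.src e)) (Q : G.Walk z₀ (G.tgt e)),
    G.IsPathIn T P ∧ G.IsPathIn T Q ∧
    σ = ((P.transport γ).trans (γ e)).trans (Q.transport γ).symm}

end HomotopyGraph

/-! ## Monodromy -/

/-- `Γ` is a continuous lift of `γ` to `X`. -/
def IsLift {m n : ℕ} (X : Set (CVec m × CVec n)) {u v : CVec m} (γ : Path u v)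
    (Γ : unitInterval → CVec n) : Prop :=
  Continuous Γ ∧ ∀ t, (γ t, Γ t) ∈ X

/-- The loop `γ` induces the permutation `σ` of the set `K` of solutions by analytic continuation:
for each `a ∈ K` there is a lift of `γ` to `X` that starts at `a`, and every such lift ends
at `σ a`. -/
def Induces {m n : ℕ} (X : Set (CVec m × CVec n)) {z : CVec m} (γ : Path z z)
    {K : Set (CVec n)} (σ : Equiv.Perm K) : Prop :=
  ∀ a : K, (∃ Γ, IsLift X γ Γ ∧ Γ 0 = a) ∧ ∀ Γ, IsLift X γ Γ → Γ 0 = a → Γ 1 = σ a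

/-- The monodromy group `Mon_π` at `z`: the permutations of the fiber induced by loops at `z` that
avoid the discriminant. -/
def monodromyGroup {m n : ℕ} (X : Set (CVec m × CVec n)) (d : ℕ) (z : CVec m) :
    Subgroup (Equiv.Perm (fiber X z)) :=
  Subgroup.closure {σ | ∃ γ : Path z z, (∀ t, γ t ∉ discriminant X d) ∧ Induces X γ σ}

/-- The group `Mon_{G,z₀}`, acting on a set `K` of solutions at `z₀`: it is generated by the
permutations induced by the loops of all closed walks at `z₀`. -/
def graphMonodromyGroup {m n : ℕ} {V E : Type*} (X : Set (CVec m × CVec n))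
    (G : HomotopyGraph m V E) (z₀ : V) (K : Set (CVec n)) : Subgroup (Equiv.Perm K) :=
  Subgroup.closure {σ | ∃ W : G.Walk z₀ z₀, Induces X W.toPath σ}

/-! ## Certified monodromy computation -/

/-- State of the computation: the known solutions at each vertex, and the pairs recorded for each
edge `e = (u, v)`, whose first entry lies over `u` and whose second entry lies over `v`. -/
structure CompState (n : ℕ) (V E : Type*) where
  known : V → Set (CVec n)
  corr : E → Set (CVec n × CVec n)

namespace CompState

variable {m n : ℕ} {V E : Type*}

/-- Each known solution at one end of the edge `e` corresponds to one at the other end. -/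
def EdgeSaturated (G : HomotopyGraph m V E) (s : CompState n V E) (e : E) : Prop :=
  (∀ a ∈ s.known (G.src e), ∃ b ∈ s.known (G.tgt e), (a, b) ∈ s.corr e) ∧
  (∀ b ∈ s.known (G.tgt e), ∃ a ∈ s.known (G.src e), (a, b) ∈ s.corr e)

def Saturated (G : HomotopyGraph m V E) (s : CompState n V E) : Prop :=
  ∀ e, s.EdgeSaturated G e

open Classical in
/-- Add solutions at the vertex `v` and recorded pairs at the edge `e`. -/
def record (s : CompState n V E) (v : V) (N : Set (CVec n)) (e : E)
    (R : Set (CVec n × CVec n)) : CompState n V E where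
  known := Function.update s.known v (s.known v ∪ N)
  corr := Function.update s.corr e (s.corr e ∪ R)

open Classical in
/-- Initially the fabricated solution `x₀` over the base vertex is the only known solution. -/
def init (z₀ : V) (x₀ : CVec n) : CompState n V E where
  known := Function.update (fun _ => ∅) z₀ {x₀}
  corr := fun _ => ∅

/-- One step of the computation: all known solutions at one end of an edge that is not saturated
are transported to the other end by `CertifiedTrack`, and the results are recorded. -/
inductive Step (c : TrackConstants) (F : SquareSystem m n) (G : HomotopyGraph m V E) :
    CompState n V E → CompState n V E → Prop
  | fwd (s : CompState n V E) (e : E) (he : ¬ s.EdgeSaturated G e) (f : CVec n → CVec n)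
      (hf : ∀ a ∈ s.known (G.src e), Tracked c F (G.path e) a (f a)) :
      Step c F G s (s.record (G.tgt e) (f '' s.known (G.src e)) e
        ((fun a => (a, f a)) '' s.known (G.src e)))
  | bwd (s : CompState n V E) (e : E) (he : ¬ s.EdgeSaturated G e) (f : CVec n → CVec n)
      (hf : ∀ b ∈ s.known (G.tgt e), Tracked c F (G.path e).symm b (f b)) :
      Step c F G s (s.record (G.src e) (f '' s.known (G.tgt e)) e
        ((fun b => (f b, b)) '' s.known (G.tgt e)))

end CompState

/-- The main loop of `CertifiedMonodromyComputation`, started with the fabricated pair over `z₀`,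
may end in the state `s`; the graph is then saturated. -/
def CertifiedMonodromyRun {m n : ℕ} {V E : Type*} (c : TrackConstants) (F : SquareSystem m n)
    (G : HomotopyGraph m V E) (z₀ : V) (x₀ : CVec n) (s : CompState n V E) : Prop :=
  Relation.ReflTransGen (CompState.Step c F G) (CompState.init z₀ x₀) s ∧ s.Saturated G

end CertMon

end

namespace CertMon

variable {m n : ℕ}

/-! ## Analytic properties of parametrized systems -/

/-! Passing a Krawczyk test with constant below 1 makes the quasi-Newton map `y ↦ y - A F(y; z)` a
contraction of `C + rB` that sends each box `x + rB`, `x ∈ C`, into itself. So each such box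
contains a zero, and all of `C + rB` contains no other. This zero is regular and depends
continuously on the parameter (`existsZero`, `zero_unique`, `regularZero`, `continuousOn_zero`).
Uniqueness on the whole thickened box glues the zeros of successive tracking steps, and `Refine`
keeps the associated zero. A terminating run thus follows a continuous lift of the path through
regular zeros of `F` (`Tracked.exists_isRegularLift`).

Such a lift is then compared with `X`. Near a regular zero, the zeros of `F` form the graph of an
analytic function of `z`. If this zero lies on `X`, density of the regular samples puts an open
piece of the graph on `X`, and the identity theorem puts all of it there
(`LocallyDefines.eventually_mem`). Conversely, `F` vanishes on `X` wherever it is defined. Hence a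
regular lift starting on `X` stays on `X`, and any lift to `X` that meets it coincides with it. No
covering-space theory is needed: the tracked lift carries its own uniqueness, at both ends, which is
what `Transports` records.

Two-sided uniqueness turns the recorded pairs of a saturated graph into bijections and makes the
transport along a closed walk the permutation induced by its loop. The rest is combinatorial. Closed
walks in a tree have trivial transport, so the fundamental cycles generate all transports of closed
walks (`transport_mem_closure`). Every known solution is reached from `x₀` along a walk, which gives
transitivity. -/

theorem analyticAt_evalAt (f : ParamPoly m n) (q : CVec m × CVec n) :
    AnalyticAt ℂ (fun q : CVec m × CVec n => evalAt f q.1 q.2) q := by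
  refine AnalyticAt.aeval_mvPolynomial (A := ℂ)
    (f := fun q : CVec m × CVec n => Sum.elim q.1 q.2) ?_ f
  rintro (i | j)
  · exact ((ContinuousLinearMap.proj (R := ℂ) (φ := fun _ : Fin m => ℂ) i).comp
      (ContinuousLinearMap.fst ℂ (CVec m) (CVec n))).analyticAt q
  · exact ((ContinuousLinearMap.proj (R := ℂ) (φ := fun _ : Fin n => ℂ) j).comp
      (ContinuousLinearMap.snd ℂ (CVec m) (CVec n))).analyticAt q

theorem continuous_evalAt (f : ParamPoly m n) :
    Continuous (fun q : CVec m × CVec n => evalAt f q.1 q.2) :=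
  continuous_iff_continuousAt.2 fun q => (analyticAt_evalAt f q).continuousAt

theorem hasFDerivAt_evalAt (f : ParamPoly m n) (z : CVec m) (x : CVec n) :
    HasFDerivAt (fun x => evalAt f z x)
      (∑ j, evalAt (MvPolynomial.pderiv (Sum.inr j) f) z x •
        ContinuousLinearMap.proj (R := ℂ) (φ := fun _ : Fin n => ℂ) j) x := by
  induction f using MvPolynomial.induction_on with
  | C a =>
    refine (hasFDerivAt_const a x).congr_fderiv ?_ |>.congr_of_eventuallyEq ?_
    · ext v
      simp [evalAt]
    · exact Filter.Eventually.of_forall fun x => by simp [evalAt]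
  | add p q hp hq =>
    refine (hp.add hq).congr_fderiv ?_ |>.congr_of_eventuallyEq ?_
    · ext v
      simp [evalAt, add_mul, Finset.sum_add_distrib]
    · exact Filter.Eventually.of_forall fun x => by simp [evalAt]
  | mul_X p i hp =>
    have hX : HasFDerivAt (fun x : CVec n => Sum.elim z x i)
        (∑ j, evalAt (MvPolynomial.pderiv (Sum.inr j) (MvPolynomial.X i)) z x •
          ContinuousLinearMap.proj (R := ℂ) (φ := fun _ : Fin n => ℂ) j) x := by
      rcases i with i | i
      · refine (hasFDerivAt_const (z i) x).congr_fderiv ?_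
        ext v
        simp [evalAt, MvPolynomial.pderiv_X]
      · refine ((ContinuousLinearMap.proj (R := ℂ) (φ := fun _ : Fin n => ℂ) i).hasFDerivAt
          (x := x)).congr_fderiv ?_
        ext v
        have h (j : Fin n) : evalAt (MvPolynomial.pderiv (Sum.inr j)
            (MvPolynomial.X (Sum.inr i) : ParamPoly m n)) z x = if i = j then 1 else 0 := by
          simp only [evalAt, MvPolynomial.pderiv_X, Pi.single_apply, Sum.inr.injEq]
          split_ifs <;> simp
        simp only [sum_apply, smul_apply, smul_eq_mul, h]
        simp
    refine (hp.mul hX).congr_fderiv ?_ |>.congr_of_eventuallyEq ?_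
    · ext v
      simp only [evalAt, map_mul, MvPolynomial.pderiv_mul, map_add,
        add_apply, smul_apply, sum_apply, smul_eq_mul, Finset.mul_sum, MvPolynomial.eval_X,
        ContinuousLinearMap.proj_apply, ← Finset.sum_add_distrib]
      exact Finset.sum_congr rfl fun j _ => by ring
    · exact Filter.Eventually.of_forall fun x => by simp [evalAt]

namespace SquareSystem

variable (F : SquareSystem m n)

theorem analyticAt_eval {q : CVec m × CVec n} (hq : F.DefinedAt q.1 q.2) :
    AnalyticAt ℂ (fun q : CVec m × CVec n => F.eval q.1 q.2) q :=
  analyticAt_pi_iff.2 fun i =>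
    (analyticAt_evalAt (F.num i) q).div (analyticAt_evalAt (F.den i) q) (hq i)

theorem eventually_definedAt {q : CVec m × CVec n} (hq : F.DefinedAt q.1 q.2) :
    ∀ᶠ q' in 𝓝 q, F.DefinedAt q'.1 q'.2 :=
  Filter.eventually_all.2 fun i =>
    (continuous_evalAt (F.den i)).continuousAt.eventually_ne (hq i)

/-- Identifies the formal quotient-rule matrix `jac`, the one that interval enclosures bound, with
the true derivative used in the mean value inequality and the inverse function theorem. -/
theorem hasFDerivAt_eval {z : CVec m} {x : CVec n} (h : F.DefinedAt z x) :
    HasFDerivAt (fun x => F.eval z x)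
      (LinearMap.toContinuousLinearMap (F.jac z x).mulVecLin) x := by
  rw [hasFDerivAt_pi']
  intro i
  have hinv : HasFDerivAt (fun x => (evalAt (F.den i) z x)⁻¹) _ x :=
    (hasDerivAt_inv (h i)).comp_hasFDerivAt x (hasFDerivAt_evalAt (F.den i) z x)
  refine ((hasFDerivAt_evalAt (F.num i) z x).mul hinv).congr_fderiv ?_
  ext v
  simp only [ContinuousLinearMap.comp_apply, ContinuousLinearMap.proj_apply, jac,
    LinearMap.coe_toContinuousLinearMap', Matrix.mulVecLin_apply, Matrix.mulVec, dotProduct,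
    Matrix.of_apply, smul_apply, add_apply,
    sum_apply, smul_eq_mul, Finset.mul_sum, ← Finset.sum_add_distrib]
  refine Finset.sum_congr rfl fun j _ => ?_
  have := h i
  field_simp
  ring

/-- `F` is defined at `(z, y)`, vanishes there, and has an invertible Jacobian. -/
structure RegularZero (z : CVec m) (y : CVec n) : Prop where
  definedAt : F.DefinedAt z y
  eval_eq_zero : F.eval z y = 0
  isUnit_det_jac : IsUnit (F.jac z y).det

theorem IsRegularSample.regularZero {F : SquareSystem m n} {X : Set (CVec m × CVec n)}
    {q : CVec m × CVec n} (h : F.IsRegularSample X q) : F.RegularZero q.1 q.2 :=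
  ⟨h.2.1, (h.2.2.2.self_of_nhds).1 h.1, h.2.2.1⟩

/-- The map `(z, x) ↦ (z, F(x; z))` has an analytic local inverse at a regular zero. -/
theorem RegularZero.exists_localInverse {F : SquareSystem m n} {z : CVec m} {y : CVec n}
    (h : F.RegularZero z y) :
    ∃ Φ : OpenPartialHomeomorph (CVec m × CVec n) (CVec m × CVec n),
      (∀ q, Φ q = (q.1, F.eval q.1 q.2)) ∧ (z, y) ∈ Φ.source ∧ AnalyticAt ℂ Φ.symm (z, 0) := by
  let φ : CVec m × CVec n → CVec m × CVec n := fun q => (q.1, F.eval q.1 q.2)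
  have hφ : AnalyticAt ℂ φ (z, y) := analyticAt_fst.prod (F.analyticAt_eval h.definedAt)
  set D := fderiv ℂ φ (z, y) with hD
  have hDφ : HasFDerivAt φ D (z, y) := hφ.differentiableAt.hasFDerivAt
  have hfst : ∀ v, (D v).1 = v.1 := by
    have h1 : HasFDerivAt (fun q => (φ q).1) ((ContinuousLinearMap.fst ℂ _ _).comp D) (z, y) :=
      hDφ.fst
    have h2 := h1.unique (hasFDerivAt_fst (𝕜 := ℂ) (p := (z, y)))
    intro v
    simpa using congrArg (fun L => L v) h2
  have hsnd : ∀ w : CVec n, (D (0, w)).2 = (F.jac z y).mulVec w := by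
    have h1 : HasFDerivAt (fun x => (φ (z, x)).2)
        (((ContinuousLinearMap.snd ℂ _ _).comp D).comp
          ((0 : CVec n →L[ℂ] CVec m).prod (ContinuousLinearMap.id ℂ (CVec n)))) y :=
      (hDφ.snd).comp y ((hasFDerivAt_const z y).prodMk (hasFDerivAt_id y))
    have h2 := h1.unique (F.hasFDerivAt_eval h.definedAt)
    intro w
    simpa using congrArg (fun L => L w) h2
  -- `D` is block triangular: the identity on the parameter component and the Jacobian on vectors
  -- `(0, w)`.
  have hinj : Function.Injective D.toLinearMap := by
    rw [← LinearMap.ker_eq_bot, LinearMap.ker_eq_bot']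
    rintro ⟨v, w⟩ hv
    have hv : D (v, w) = 0 := hv
    have hv1 : v = 0 := by have := hfst (v, w); rw [hv] at this; exact this.symm
    subst hv1
    have : (F.jac z y).mulVec w = 0 := by rw [← hsnd, hv]; rfl
    have hw : w = 0 := by
      by_contra hw
      exact h.isUnit_det_jac.ne_zero (Matrix.exists_mulVec_eq_zero_iff.1 ⟨w, hw, this⟩)
    rw [hw]; rfl
  let D' : (CVec m × CVec n) ≃L[ℂ] (CVec m × CVec n) :=
    (LinearEquiv.ofInjectiveEndo D.toLinearMap hinj).toContinuousLinearEquiv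
  have hD' : (D' : (CVec m × CVec n) →L[ℂ] (CVec m × CVec n)) = D := by
    exact ContinuousLinearMap.ext fun v => rfl
  have hs : HasStrictFDerivAt φ (D' : (CVec m × CVec n) →L[ℂ] (CVec m × CVec n)) (z, y) := by
    rw [hD']; exact hφ.hasStrictFDerivAt
  have hsrc := hs.mem_toOpenPartialHomeomorph_source
  refine ⟨hs.toOpenPartialHomeomorph φ, fun q => rfl, hsrc, ?_⟩
  have himg : (hs.toOpenPartialHomeomorph φ) (z, y) = (z, 0) := by
    change φ (z, y) = _
    simp [φ, h.eval_eq_zero]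
  have hsymm : (hs.toOpenPartialHomeomorph φ).symm (z, 0) = (z, y) := by
    rw [← himg, OpenPartialHomeomorph.left_inv _ hsrc]
  refine OpenPartialHomeomorph.analyticAt_symm (i := D') _ ?_ ?_ ?_
  · rw [← himg]; exact OpenPartialHomeomorph.map_source _ hsrc
  · rw [hsymm]; exact hφ
  · rw [hsymm, hD']; rfl

/-- Near a regular zero, zeros with equal parameters are equal. -/
theorem RegularZero.eventually_unique {F : SquareSystem m n} {z : CVec m} {y : CVec n}
    (h : F.RegularZero z y) :
    ∃ U ∈ 𝓝 (z, y), ∀ z' y₁ y₂, (z', y₁) ∈ U → (z', y₂) ∈ U →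
      F.eval z' y₁ = 0 → F.eval z' y₂ = 0 → y₁ = y₂ := by
  obtain ⟨Φ, hΦ, hsrc, -⟩ := h.exists_localInverse
  refine ⟨Φ.source, Φ.open_source.mem_nhds hsrc, fun z' y₁ y₂ h₁ h₂ e₁ e₂ => ?_⟩
  exact congrArg Prod.snd (Φ.injOn h₁ h₂ (by simp [hΦ, e₁, e₂]))

/-- Points of `X` near a point of `X` at which `F` is defined are zeros of `F`. -/
theorem LocallyDefines.eventually_eval_eq_zero {F : SquareSystem m n}
    {X : Set (CVec m × CVec n)} (hF : F.LocallyDefines X) {q : CVec m × CVec n}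
    (hq : F.DefinedAt q.1 q.2) : ∀ᶠ q' in 𝓝 q, q' ∈ X → F.eval q'.1 q'.2 = 0 := by
  filter_upwards [F.eventually_definedAt hq] with q' hq' hX
  have hc := (F.analyticAt_eval hq').continuousAt
  have hcl := mem_closure_iff_frequently.1 (hF hX)
  -- If `F` were nonzero at `q'`, it would be nonzero nearby by continuity; but regular samples,
  -- where `F` vanishes, accumulate at `q'`.
  by_contra hne
  obtain ⟨q'', h1, h2⟩ := (hcl.and_eventually (hc.eventually_ne hne)).exists
  exact h2 h1.regularZero.eval_eq_zero

/-- At a regular zero on `X`, every nearby zero of `F` lies on `X`. -/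
theorem LocallyDefines.eventually_mem {F : SquareSystem m n} {P : Set (ParamPoly m n)}
    (hF : F.LocallyDefines (solutionVariety P)) {z : CVec m} {y : CVec n}
    (h : F.RegularZero z y) (hX : (z, y) ∈ solutionVariety P) :
    ∀ᶠ q in 𝓝 (z, y), F.eval q.1 q.2 = 0 → q ∈ solutionVariety P := by
  obtain ⟨Φ, hΦ, hsrc, han⟩ := h.exists_localInverse
  have hzy : Φ (z, y) = (z, 0) := by rw [hΦ, h.eval_eq_zero]
  have htgt : (z, 0) ∈ Φ.target := hzy ▸ Φ.map_source hsrc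
  -- Over this ball the section `z' ↦ Φ.symm (z', 0)` parametrizes the zeros of `F` in `Φ.source`
  -- and is analytic.
  obtain ⟨ε, hε, hball⟩ := Metric.eventually_nhds_iff_ball.1
    (han.eventually_analyticAt.and (Φ.open_target.eventually_mem htgt))
  have hsec : ∀ z' ∈ Metric.ball z ε, ((z', 0) : CVec m × CVec n) ∈ Metric.ball (z, 0) ε := by
    intro z' hz'
    rw [← ball_prod_same]
    exact ⟨hz', Metric.mem_ball_self hε⟩
  have hN : ∀ᶠ q in 𝓝 (z, y), q ∈ Φ.source ∧ q.1 ∈ Metric.ball z ε :=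
    (Φ.open_source.eventually_mem hsrc).and
      (continuous_fst.continuousAt.eventually (Metric.ball_mem_nhds z hε))
  have hinv : ∀ q ∈ Φ.source, F.eval q.1 q.2 = 0 → Φ.symm (q.1, 0) = q := by
    intro q hq hq0
    have := Φ.left_inv hq
    rwa [hΦ q, hq0] at this
  -- A regular sample on the same graph: around it, zeros of `F` are known to lie on `X`.
  obtain ⟨q₁, hq₁, hs₁, hb₁⟩ :=
    ((mem_closure_iff_frequently.1 (hF hX)).and_eventually hN).exists
  have hq₁inv := hinv q₁ hs₁ hq₁.regularZero.eval_eq_zero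
  have hvanish : ∀ f ∈ P, ∀ z' ∈ Metric.ball z ε,
      evalAt f (Φ.symm (z', 0)).1 (Φ.symm (z', 0)).2 = 0 := by
    intro f hf
    have hA : AnalyticOnNhd ℂ
        (fun z' => evalAt f (Φ.symm (z', 0)).1 (Φ.symm (z', 0)).2) (Metric.ball z ε) := by
      intro z' hz'
      have h1 : AnalyticAt ℂ (fun z' : CVec m => ((z', 0) : CVec m × CVec n)) z' :=
        analyticAt_id.prod analyticAt_const
      have h2 : AnalyticAt ℂ (fun z' : CVec m => Φ.symm (z', 0)) z' :=
        ((hball _ (hsec z' hz')).1).comp_of_eq h1 rfl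
      exact (analyticAt_evalAt f (Φ.symm (z', 0))).comp_of_eq h2 rfl
    -- Each defining polynomial, pulled back by the section, vanishes near `q₁.1`, hence on the
    -- whole ball by the identity theorem.
    refine hA.eqOn_zero_of_preconnected_of_eventuallyEq_zero
      (convex_ball z ε).isPreconnected hb₁ ?_
    have hcont : ContinuousAt (fun z' : CVec m => Φ.symm (z', 0)) q₁.1 :=
      ((hball _ (hsec _ hb₁)).1.continuousAt).comp_of_eq (by fun_prop) rfl
    have hev := hcont.eventually (hq₁inv.symm ▸ hq₁.2.2.2)
    filter_upwards [hev, Metric.isOpen_ball.eventually_mem hb₁] with z' hz' hz'b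
    refine hz'.2 ?_ f hf
    have := Φ.right_inv (hball _ (hsec z' hz'b)).2
    rw [hΦ] at this
    exact congrArg Prod.snd this
  filter_upwards [hN] with q hq hq0 f hf
  have := hvanish f hf q.1 hq.2
  rwa [hinv q hq.1 hq0] at this

end SquareSystem

theorem isClosed_solutionVariety (P : Set (ParamPoly m n)) : IsClosed (solutionVariety P) := by
  have : solutionVariety P = ⋂ f ∈ P, {q | evalAt f q.1 q.2 = 0} := by
    ext q; simp [solutionVariety]
  rw [this]
  exact isClosed_biInter fun f _ => isClosed_eq (continuous_evalAt f) continuous_const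

end CertMon

namespace CertMon

variable {m n : ℕ}

/-! ## The box norm -/

/-- Real and imaginary parts of the coordinates, as a real linear map. -/
noncomputable def reImCLM (n : ℕ) : CVec n →L[ℝ] (Fin n → ℝ × ℝ) :=
  ContinuousLinearMap.pi fun i =>
    (Complex.reCLM.comp (ContinuousLinearMap.proj i)).prod
      (Complex.imCLM.comp (ContinuousLinearMap.proj i))

/-- Pulling back the sup norm along a real linear map gives the triangle inequality, real
homogeneity and continuity at once. -/
theorem boxNorm_eq_norm (v : CVec n) : boxNorm v = ‖reImCLM n v‖ := by
  rw [boxNorm, Pi.norm_def, Pi.norm_def]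
  congr 2
  ext i
  simp [reImCLM]

theorem boxNorm_nonneg (v : CVec n) : 0 ≤ boxNorm v := norm_nonneg _

theorem boxNorm_zero : boxNorm (0 : CVec n) = 0 := by simp [boxNorm_eq_norm]

theorem boxNorm_neg (v : CVec n) : boxNorm (-v) = boxNorm v := by simp [boxNorm_eq_norm]

theorem boxNorm_sub_comm (v w : CVec n) : boxNorm (v - w) = boxNorm (w - v) := by
  rw [← boxNorm_neg, neg_sub]

theorem boxNorm_add_le (v w : CVec n) : boxNorm (v + w) ≤ boxNorm v + boxNorm w := by
  simpa [boxNorm_eq_norm] using norm_add_le (reImCLM n v) (reImCLM n w)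

theorem boxNorm_sub_le (u v w : CVec n) : boxNorm (u - w) ≤ boxNorm (u - v) + boxNorm (v - w) := by
  simpa using boxNorm_add_le (u - v) (v - w)

theorem boxNorm_smul (t : ℝ) (v : CVec n) : boxNorm (t • v) = |t| * boxNorm v := by
  simp [boxNorm_eq_norm, norm_smul]

theorem norm_le_two_mul_boxNorm (v : CVec n) : ‖v‖ ≤ 2 * boxNorm v := by
  refine (pi_norm_le_iff_of_nonneg (by have := boxNorm_nonneg v; positivity)).2 fun i => ?_
  have h : ‖max |(v i).re| |(v i).im|‖ ≤ boxNorm v :=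
    norm_le_pi_norm (fun i => max |(v i).re| |(v i).im| : Fin n → ℝ) i
  rw [Real.norm_of_nonneg (le_max_of_le_left (abs_nonneg _))] at h
  linarith [Complex.norm_le_abs_re_add_abs_im (v i), le_max_left |(v i).re| |(v i).im|,
    le_max_right |(v i).re| |(v i).im|]

theorem boxNorm_eq_zero {v : CVec n} (h : boxNorm v ≤ 0) : v = 0 :=
  norm_le_zero_iff.1 ((norm_le_two_mul_boxNorm v).trans (by linarith))

theorem continuous_boxNorm : Continuous (boxNorm : CVec n → ℝ) := by
  have : (boxNorm : CVec n → ℝ) = fun v => ‖reImCLM n v‖ := funext boxNorm_eq_norm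
  rw [this]
  fun_prop

theorem isCompact_boxBall (x : CVec n) (r : ℝ) : IsCompact {y : CVec n | boxNorm (y - x) ≤ r} := by
  refine Metric.isCompact_of_isClosed_isBounded ?_ ?_
  · exact isClosed_le (continuous_boxNorm.comp (continuous_id.sub continuous_const))
      continuous_const
  · refine (Metric.isBounded_closedBall (x := x) (r := 2 * r)).subset fun y hy => ?_
    rw [mem_closedBall_iff_norm]
    have hy : boxNorm (y - x) ≤ r := hy
    linarith [norm_le_two_mul_boxNorm (y - x)]

/-- Keeps segments between points of `C + rB` inside the region where the Jacobian is enclosed, as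
the mean value inequality requires. -/
theorem convex_thicken {C : Set (CVec n)} (hC : Convex ℝ C) (r : ℝ) :
    Convex ℝ (thicken C r) := by
  rintro y₁ ⟨x₁, hx₁, h₁⟩ y₂ ⟨x₂, hx₂, h₂⟩ a b ha hb hab
  refine ⟨a • x₁ + b • x₂, hC hx₁ hx₂ ha hb hab, ?_⟩
  have e : a • y₁ + b • y₂ - (a • x₁ + b • x₂) = a • (y₁ - x₁) + b • (y₂ - x₂) := by
    simp only [smul_sub]; abel
  rw [e]
  refine (boxNorm_add_le _ _).trans ?_
  rw [boxNorm_smul, boxNorm_smul, abs_of_nonneg ha, abs_of_nonneg hb]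
  have : r = a * r + b * r := by rw [← add_mul, hab, one_mul]
  rw [this]
  gcongr

theorem convex_boxSet (I : Fin n → CInterval) : Convex ℝ (boxSet I) := by
  intro x hx y hy a b ha hb hab i
  have h1 := convex_Icc (I i).re.fst (I i).re.snd (hx i).1 (hy i).1 ha hb hab
  have h2 := convex_Icc (I i).im.fst (I i).im.snd (hx i).2 (hy i).2 ha hb hab
  refine ⟨NonemptyInterval.mem_def.2 ?_, NonemptyInterval.mem_def.2 ?_⟩
  · simpa using h1
  · simpa using h2

/-! ## Consequences of the Krawczyk test -/

/-- The quasi-Newton map `y ↦ y - A F(y; z)`. -/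
noncomputable def newtonMap (F : SquareSystem m n) (z : CVec m) (A : Matrix (Fin n) (Fin n) ℂ)
    (y : CVec n) : CVec n :=
  y - A.mulVec (F.eval z y)

variable {F : SquareSystem m n} {z : CVec m} {A : Matrix (Fin n) (Fin n) ℂ}

theorem hasFDerivAt_newtonMap {y : CVec n} (h : F.DefinedAt z y) :
    HasFDerivAt (newtonMap F z A)
      (LinearMap.toContinuousLinearMap (1 - A * F.jac z y).mulVecLin) y := by
  have h1 : HasFDerivAt (fun y => A.mulVec (F.eval z y))
      ((LinearMap.toContinuousLinearMap A.mulVecLin).comp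
        (LinearMap.toContinuousLinearMap (F.jac z y).mulVecLin)) y :=
    (LinearMap.toContinuousLinearMap A.mulVecLin).hasFDerivAt.comp y (F.hasFDerivAt_eval h)
  refine ((hasFDerivAt_id y).sub h1).congr_fderiv (ContinuousLinearMap.ext fun v => ?_)
  simp [Matrix.mulVec_mulVec]

/-- Mean value inequality for the quasi-Newton map along a segment. -/
theorem boxNorm_newtonMap_sub_add_le {y v w : CVec n} {M : ℝ}
    (hdef : ∀ s ∈ Set.Icc (0 : ℝ) 1, F.DefinedAt z (y + s • v))
    (hM : ∀ s ∈ Set.Icc (0 : ℝ) 1, boxNorm ((1 - A * F.jac z (y + s • v)).mulVec v + w) ≤ M) :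
    boxNorm (newtonMap F z A (y + v) - newtonMap F z A y + w) ≤ M := by
  -- The term `s • w` puts the constant `w` under the derivative. Taking `w = 0` yields the
  -- contraction estimate, and `w = -A F(x)` yields the self-map estimate.
  have hderiv : ∀ s ∈ Set.Icc (0 : ℝ) 1,
      HasDerivAt (fun s : ℝ => reImCLM n (newtonMap F z A (y + s • v) + s • w))
        (reImCLM n ((1 - A * F.jac z (y + s • v)).mulVec v + w)) s := by
    intro s hs
    have h0 : HasDerivAt (fun s : ℝ => y + s • v) v s := by
      simpa using ((hasDerivAt_id s).smul_const v).const_add y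
    have h1 := ((hasFDerivAt_newtonMap (A := A) (hdef s hs)).restrictScalars ℝ).comp_hasDerivAt s h0
    have h2 : HasDerivAt (fun s : ℝ => s • w) w s := by
      simpa using (hasDerivAt_id s).smul_const w
    exact (reImCLM n).hasFDerivAt.comp_hasDerivAt s (h1.add h2)
  have := norm_image_sub_le_of_norm_deriv_le_segment_01'
    (fun s hs => (hderiv s hs).hasDerivWithinAt)
    (fun s hs => by
      rw [← boxNorm_eq_norm]; exact hM s (Set.Ico_subset_Icc_self hs))
  rw [← map_sub, ← boxNorm_eq_norm] at this
  convert this using 2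
  simp
  abel

theorem newtonMap_eq_self_of_eval_eq_zero {y : CVec n} (h : F.eval z y = 0) :
    newtonMap F z A y = y := by
  simp [newtonMap, h]

namespace KrawczykTest

variable {Z : Set (CVec m)} {C : Set (CVec n)} {r ρ : ℝ}

theorem mono {Z' : Set (CVec m)} {C' : Set (CVec n)} (h : KrawczykTest F Z C r A ρ)
    (hZ : Z' ⊆ Z) (hC : C' ⊆ C) : KrawczykTest F Z' C' r A ρ := by
  obtain ⟨hr, hA, FI, JI, h1, h2, h3⟩ := h
  refine ⟨hr, hA, FI, JI, fun z hz x hx => h1 z (hZ hz) x (hC hx), fun z hz y hy => ?_, h3⟩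
  obtain ⟨x, hx, hxy⟩ := hy
  exact h2 z (hZ hz) y ⟨x, hC hx, hxy⟩

theorem definedAt (h : KrawczykTest F Z C r A ρ) (hz : z ∈ Z) {y : CVec n}
    (hy : y ∈ thicken C r) : F.DefinedAt z y := by
  obtain ⟨-, -, _, _, -, h2, -⟩ := h
  exact (h2 z hz y hy).1

theorem bound (h : KrawczykTest F Z C r A ρ) (hz : z ∈ Z) {x y b : CVec n}
    (hx : x ∈ C) (hy : y ∈ thicken C r) (hb : boxNorm b ≤ 1) :
    boxNorm (-(r⁻¹ • A.mulVec (F.eval z x)) + (1 - A * F.jac z y).mulVec b) < ρ := by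
  obtain ⟨-, -, FI, JI, h1, h2, h3⟩ := h
  have := h3 _ (h1 z hz x hx).2 _ (h2 z hz y hy).2 b hb
  rwa [← Complex.ofReal_inv, Complex.coe_smul] at this

/-- The test bounds the sum of a Newton term and a Jacobian term. Using it at `b` and `-b` and
subtracting cancels the Newton term, leaving `2 (1 - A J) b` of norm at most `2ρ`; rescaling handles
general `v`. -/
theorem boxNorm_mulVec_le (h : KrawczykTest F Z C r A ρ) (hz : z ∈ Z) {y : CVec n}
    (hy : y ∈ thicken C r) (v : CVec n) :
    boxNorm ((1 - A * F.jac z y).mulVec v) ≤ ρ * boxNorm v := by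
  rcases (boxNorm_nonneg v).eq_or_lt with h0 | h0
  · rw [boxNorm_eq_zero h0.ge]; simp [boxNorm_zero]
  obtain ⟨x, hx, hxy⟩ := id hy
  set t := boxNorm v with ht
  have hb : boxNorm (t⁻¹ • v) ≤ 1 := by
    rw [boxNorm_smul, abs_of_pos (inv_pos.2 h0), ← ht, inv_mul_cancel₀ h0.ne']
  have h1 := h.bound hz hx hy hb
  have h2 := h.bound hz hx hy (b := -(t⁻¹ • v)) (by rwa [boxNorm_neg])
  set u := r⁻¹ • A.mulVec (F.eval z x)
  rw [Matrix.mulVec_neg] at h2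
  rw [Matrix.mulVec_smul] at h1 h2
  set w := (1 - A * F.jac z y).mulVec v
  have e : ((2 : ℝ) * t⁻¹) • w = (-u + t⁻¹ • w) - (-u + -(t⁻¹ • w)) := by
    rw [mul_smul, two_smul]; abel
  have h3 : boxNorm (((2 : ℝ) * t⁻¹) • w) ≤ ρ + ρ := by
    rw [e, sub_eq_add_neg]
    refine (boxNorm_add_le _ _).trans ?_
    rw [boxNorm_neg]
    linarith
  rw [boxNorm_smul, abs_of_pos (by positivity)] at h3
  have h4 : t⁻¹ * boxNorm w ≤ ρ := by linarith
  rw [inv_mul_le_iff₀ h0] at h4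
  linarith

/-- The derivative of the quasi-Newton map is `1 - A J`, of operator norm at most `ρ` along the
segment. -/
theorem newtonMap_contract (h : KrawczykTest F Z C r A ρ) (hC : Convex ℝ C) (hz : z ∈ Z)
    {y y' : CVec n} (hy : y ∈ thicken C r) (hy' : y' ∈ thicken C r) :
    boxNorm (newtonMap F z A y' - newtonMap F z A y) ≤ ρ * boxNorm (y' - y) := by
  have hmem : ∀ s ∈ Set.Icc (0 : ℝ) 1, y + s • (y' - y) ∈ thicken C r := fun s hs =>
    (convex_thicken hC r).add_smul_sub_mem hy hy' hs
  have := boxNorm_newtonMap_sub_add_le (F := F) (z := z) (A := A) (y := y) (v := y' - y) (w := 0)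
    (fun s hs => h.definedAt hz (hmem s hs))
    (fun s hs => by rw [add_zero]; exact h.boxNorm_mulVec_le hz (hmem s hs) _)
  simpa using this

/-- The difference from the center is `(N y - N x) - A F(x)`. Along the segment, derivative plus
shift equals `r` times an element of the set `K` of the test, hence has norm at most `ρ r`. -/
theorem boxNorm_newtonMap_sub_le (h : KrawczykTest F Z C r A ρ) (hz : z ∈ Z) {x y : CVec n}
    (hx : x ∈ C) (hy : boxNorm (y - x) ≤ r) : boxNorm (newtonMap F z A y - x) ≤ ρ * r := by
  have hr := h.1
  have hmem : ∀ s ∈ Set.Icc (0 : ℝ) 1, x + s • (y - x) ∈ thicken C r := by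
    intro s hs
    refine ⟨x, hx, ?_⟩
    rw [add_sub_cancel_left, boxNorm_smul, abs_of_nonneg hs.1]
    nlinarith [hs.1, hs.2, boxNorm_nonneg (y - x)]
  have hb : boxNorm (r⁻¹ • (y - x)) ≤ 1 := by
    rw [boxNorm_smul, abs_of_pos (inv_pos.2 hr), inv_mul_le_iff₀ hr, mul_one]; exact hy
  have := boxNorm_newtonMap_sub_add_le (F := F) (z := z) (A := A) (y := x) (v := y - x)
    (w := -A.mulVec (F.eval z x)) (M := ρ * r)
    (fun s hs => h.definedAt hz (hmem s hs))
    (fun s hs => by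
      have h1 := (h.bound hz hx (hmem s hs) hb).le
      rw [Matrix.mulVec_smul, ← smul_neg, ← smul_add, boxNorm_smul, abs_of_pos (inv_pos.2 hr),
        inv_mul_le_iff₀ hr] at h1
      rw [add_comm, mul_comm ρ]
      exact h1)
  convert this using 2
  simp only [newtonMap, add_sub_cancel]
  abel

theorem eval_eq_zero_of_fixed (h : KrawczykTest F Z C r A ρ) {y : CVec n}
    (hy : newtonMap F z A y = y) : F.eval z y = 0 := by
  have h0 : A.mulVec (F.eval z y) = 0 := by simpa [newtonMap] using hy
  by_contra hne
  exact h.2.1.ne_zero (Matrix.exists_mulVec_eq_zero_iff.1 ⟨_, hne, h0⟩)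

/-- On the compact box the displacement `‖N y - y‖` attains its minimum. Applying `N` once more
stays in the box and shrinks the displacement by `ρ < 1`, so the minimum is 0; a fixed point is a
zero because `A` is invertible. -/
theorem existsZero (h : KrawczykTest F Z C r A ρ) (hC : Convex ℝ C) (hρ : ρ < 1) (hz : z ∈ Z)
    {x : CVec n} (hx : x ∈ C) : ∃ y, boxNorm (y - x) ≤ r ∧ F.eval z y = 0 := by
  have hr := h.1
  have hsub : {y : CVec n | boxNorm (y - x) ≤ r} ⊆ thicken C r := fun y hy => ⟨x, hx, hy⟩
  have hcont : ContinuousOn (fun y => boxNorm (newtonMap F z A y - y))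
      {y : CVec n | boxNorm (y - x) ≤ r} := fun y hy =>
    (continuous_boxNorm.continuousAt.comp
      ((hasFDerivAt_newtonMap (h.definedAt hz (hsub hy))).continuousAt.sub
        continuousAt_id)).continuousWithinAt
  obtain ⟨y, hy, hmin⟩ := (isCompact_boxBall x r).exists_isMinOn
    ⟨x, by simpa [boxNorm_zero] using hr.le⟩ hcont
  refine ⟨y, hy, h.eval_eq_zero_of_fixed (z := z) ?_⟩
  have hTy : newtonMap F z A y ∈ {y : CVec n | boxNorm (y - x) ≤ r} := by
    have := h.boxNorm_newtonMap_sub_le hz hx hy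
    exact this.trans (by nlinarith)
  have h1 : boxNorm (newtonMap F z A y - y) ≤
      boxNorm (newtonMap F z A (newtonMap F z A y) - newtonMap F z A y) := hmin hTy
  have h2 := h.newtonMap_contract hC hz (hsub hy) (hsub hTy)
  refine sub_eq_zero.1 (boxNorm_eq_zero ?_)
  nlinarith [boxNorm_nonneg (newtonMap F z A y - y)]

theorem zero_unique (h : KrawczykTest F Z C r A ρ) (hC : Convex ℝ C) (hρ : ρ < 1) (hz : z ∈ Z)
    {y y' : CVec n} (hy : y ∈ thicken C r) (hy' : y' ∈ thicken C r)
    (h0 : F.eval z y = 0) (h0' : F.eval z y' = 0) : y = y' := by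
  have h1 := h.newtonMap_contract hC hz hy' hy
  rw [newtonMap_eq_self_of_eval_eq_zero h0, newtonMap_eq_self_of_eval_eq_zero h0'] at h1
  refine sub_eq_zero.1 (boxNorm_eq_zero ?_)
  nlinarith [boxNorm_nonneg (y - y')]

/-- A kernel vector `v` of the Jacobian would satisfy `‖v‖ = ‖(1 - A J) v‖ ≤ ρ ‖v‖`. -/
theorem regularZero (h : KrawczykTest F Z C r A ρ) (hρ : ρ < 1) (hz : z ∈ Z)
    {y : CVec n} (hy : y ∈ thicken C r) (h0 : F.eval z y = 0) : F.RegularZero z y := by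
  refine ⟨h.definedAt hz hy, h0, isUnit_iff_ne_zero.2 fun hdet => ?_⟩
  obtain ⟨v, hv, hv0⟩ := Matrix.exists_mulVec_eq_zero_iff.2 hdet
  have h1 := h.boxNorm_mulVec_le hz hy v
  rw [Matrix.sub_mulVec, ← Matrix.mulVec_mulVec, hv0] at h1
  simp only [Matrix.one_mulVec, Matrix.mulVec_zero, sub_zero] at h1
  exact hv (boxNorm_eq_zero (by nlinarith [boxNorm_nonneg v]))

/-- The certified zeros depend continuously on the parameter. -/
theorem continuousOn_zero {T : Type*} [TopologicalSpace T] {I : Set T} {p : T → CVec m}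
    (hp : ContinuousOn p I) (h : KrawczykTest F (p '' I) C r A ρ) (hC : Convex ℝ C) (hρ : ρ < 1)
    {Y : T → CVec n} (hY : ∀ t ∈ I, Y t ∈ thicken C r) (h0 : ∀ t ∈ I, F.eval (p t) (Y t) = 0) :
    ContinuousOn Y I := by
  intro t₀ ht₀
  have hg : Filter.Tendsto (fun t => A.mulVec (F.eval (p t) (Y t₀))) (𝓝[I] t₀) (𝓝 0) := by
    have hc : Filter.Tendsto (fun q : CVec m × CVec n => F.eval q.1 q.2) (𝓝 (p t₀, Y t₀))
        (𝓝 (F.eval (p t₀) (Y t₀))) :=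
      (F.analyticAt_eval (q := (p t₀, Y t₀))
        (h.definedAt ⟨t₀, ht₀, rfl⟩ (hY t₀ ht₀))).continuousAt
    have hpair : Filter.Tendsto (fun t => (p t, Y t₀)) (𝓝[I] t₀) (𝓝 (p t₀, Y t₀)) :=
      Filter.Tendsto.prodMk_nhds (hp t₀ ht₀) tendsto_const_nhds
    have h1 := hc.comp hpair
    have h2 : Continuous fun v : CVec n => A.mulVec v := by fun_prop
    refine (h2.tendsto' 0 0 (Matrix.mulVec_zero A)).comp ?_
    rwa [h0 t₀ ht₀] at h1
  -- Contraction gives `(1 - ρ) ‖Y t - Y t₀‖ ≤ ‖A F(Y t₀; p t)‖`, which tends to 0. The factor 2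
  -- compares the ambient norm with the box norm.
  have hlim : Filter.Tendsto (fun t => 2 * ((1 - ρ)⁻¹ * boxNorm (A.mulVec (F.eval (p t) (Y t₀)))))
      (𝓝[I] t₀) (𝓝 0) := by
    have := ((continuous_boxNorm.tendsto' 0 0 boxNorm_zero).comp hg).const_mul (2 * (1 - ρ)⁻¹)
    simpa [mul_assoc] using this
  refine tendsto_iff_norm_sub_tendsto_zero.2 (squeeze_zero' (Filter.Eventually.of_forall
    fun _ => norm_nonneg _) ?_ hlim)
  filter_upwards [self_mem_nhdsWithin] with t ht
  refine (norm_le_two_mul_boxNorm _).trans ?_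
  gcongr
  rw [le_inv_mul_iff₀ (by linarith)]
  have h1 := h.newtonMap_contract hC ⟨t, ht, rfl⟩ (hY t₀ ht₀) (hY t ht)
  rw [newtonMap_eq_self_of_eval_eq_zero (h0 t ht)] at h1
  have h2 := boxNorm_sub_le (Y t) (newtonMap F (p t) A (Y t₀)) (Y t₀)
  have h3 : newtonMap F (p t) A (Y t₀) - Y t₀ = -A.mulVec (F.eval (p t) (Y t₀)) := by
    simp [newtonMap]
  rw [h3, boxNorm_neg] at h2
  linarith

end KrawczykTest

end CertMon

namespace CertMon

variable {m n : ℕ}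

/-! ## Certified tracking follows a continuous path of regular zeros -/

variable {F : SquareSystem m n} {c : TrackConstants}

theorem mem_thicken_singleton {x y : CVec n} {r : ℝ} (h : boxNorm (y - x) ≤ r) :
    y ∈ thicken {x} r := ⟨x, rfl, h⟩

/-- A zero certified at one radius lies within every other certified radius about the same
center. -/
theorem KrawczykTest.boxNorm_sub_le_of_same_center {z : CVec m} {x a : CVec n} {r r' ρ ρ' : ℝ}
    {A A' : Matrix (Fin n) (Fin n) ℂ} (h : KrawczykTest F {z} {x} r A ρ) (hρ : ρ < 1)
    (h' : KrawczykTest F {z} {x} r' A' ρ') (hρ' : ρ' < 1) (ha0 : F.eval z a = 0)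
    (ha : boxNorm (a - x) ≤ r) : boxNorm (a - x) ≤ r' := by
  -- Only a smaller `r'` needs an argument: its box contains a zero of its own, which uniqueness at
  -- radius `r` identifies with `a`.
  rcases le_total r r' with hr | hr
  · exact ha.trans hr
  obtain ⟨a', ha', ha0'⟩ := h'.existsZero (convex_singleton x) hρ' rfl rfl
  rwa [h.zero_unique (convex_singleton x) hρ rfl (mem_thicken_singleton ha)
    (mem_thicken_singleton (ha'.trans hr)) ha0 ha0']

theorem TrackConstants.ρ_lt_one (c : TrackConstants) : c.ρ < 1 :=
  c.ρ_mem.2.trans_lt (by norm_num)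

/-- The first loop of `Refine` keeps the associated zero within the current radius. -/
theorem RefineShrinkStep.invariant {z : CVec m} {s s₁ : Certificate n} {a : CVec n}
    (h : KrawczykTest F {z} {s.x} s.r s.A c.τ) (ha0 : F.eval z a = 0)
    (ha : boxNorm (a - s.x) ≤ s.r)
    (hs : Relation.ReflTransGen (RefineShrinkStep c F z s.A) s s₁) :
    boxNorm (s₁.x - s.x) ≤ s.r ∧ boxNorm (a - s₁.x) ≤ s₁.r := by
  have hτ := c.τ_mem.2
  have hr := h.1
  induction hs with
  | refl => exact ⟨by simpa [boxNorm_zero] using hr.le, ha⟩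
  | @tail s₁ s₂ _ hstep ih =>
    obtain ⟨ih1, ih2⟩ := ih
    -- Steps use the input matrix, so the contraction comes from the input test. This is why the
    -- invariant also keeps the current point in the input box.
    have hcon := h.newtonMap_contract (convex_singleton s.x) rfl
      (mem_thicken_singleton ha) (mem_thicken_singleton ih1)
    rw [newtonMap_eq_self_of_eval_eq_zero ha0] at hcon
    cases hstep with
    | halve hle =>
      refine ⟨ih1, ?_⟩
      have h1 := boxNorm_sub_le s₁.x (newtonMap F z s.A s₁.x) a
      have h2 : s₁.x - newtonMap F z s.A s₁.x = s.A.mulVec (F.eval z s₁.x) := by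
        simp [newtonMap]
      rw [h2] at h1
      rw [boxNorm_sub_comm] at ih2 ⊢
      have h0 := boxNorm_nonneg (s₁.x - a)
      -- From `‖x - a‖ ≤ ‖A f(x)‖ + τ ‖x - a‖`, the halving criterion with `g < 1 - τ` and `ρ ≤ 1/2`
      -- gives exactly `‖x - a‖ ≤ r / 2`.
      have h3 : c.g * c.ρ * s₁.r ≤ (1 - c.τ) * (1 / 2) * s₁.r := by
        gcongr
        · exact h0.trans ih2
        · exact c.ρ_mem.1.le
        · exact c.g_mem.2.le
        · exact c.ρ_mem.2
      change boxNorm (s₁.x - a) ≤ s₁.r / 2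
      have h4 : (1 - c.τ) * boxNorm (s₁.x - a) ≤ (1 - c.τ) * (s₁.r / 2) := by linarith
      exact le_of_mul_le_mul_left h4 (by linarith)
    | newton hle =>
      refine ⟨?_, ?_⟩
      · have := h.boxNorm_newtonMap_sub_le (z := z) rfl rfl ih1
        change boxNorm (newtonMap F z s.A s₁.x - s.x) ≤ s.r
        nlinarith
      · change boxNorm (a - newtonMap F z s.A s₁.x) ≤ s₁.r
        rw [boxNorm_sub_comm] at ih2 ⊢
        nlinarith [boxNorm_nonneg (s₁.x - a)]

theorem RefineGrowStep.invariant {z : CVec m} {s s' : Certificate n} {a : CVec n}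
    (h : KrawczykTest F {z} {s.x} s.r s.A c.ρ) (ha : boxNorm (a - s.x) ≤ s.r)
    (hs : Relation.ReflTransGen (RefineGrowStep c F z) s s') :
    KrawczykTest F {z} {s'.x} s'.r s'.A c.ρ ∧ boxNorm (a - s'.x) ≤ s'.r := by
  induction hs with
  | refl => exact ⟨h, ha⟩
  | tail _ hstep ih =>
    cases hstep with
    | double _ ht =>
      refine ⟨ht, ih.2.trans ?_⟩
      have := ih.1.1
      linarith

/-- `Refine` does not change the associated zero. -/
theorem Refine.invariant {z : CVec m} {s s' : Certificate n} {a : CVec n}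
    (h : Refine c F z s s') (ha0 : F.eval z a = 0) (ha : boxNorm (a - s.x) ≤ s.r) :
    KrawczykTest F {z} {s'.x} s'.r s'.A c.ρ ∧ boxNorm (a - s'.x) ≤ s'.r := by
  obtain ⟨h0, s₁, h1, h2, h3⟩ := h
  exact RefineGrowStep.invariant h2 (RefineShrinkStep.invariant h0 ha0 ha h1).2 h3

/-- The tracker has followed a continuous path of regular zeros that starts at `a`, up to the
current time, where the path passes through the zero associated with the current certificate. -/
def TrackState.Follows (c : TrackConstants) (F : SquareSystem m n) {u v : CVec m} (p : Path u v)
    (a : CVec n) (s : TrackState n) : Prop :=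
  0 ≤ s.t ∧ s.t ≤ 1 ∧ 0 < s.h ∧ ∃ Y : ℝ → CVec n, ContinuousOn Y (Set.Icc 0 s.t) ∧ Y 0 = a ∧
    (∀ η ∈ Set.Icc 0 s.t, F.RegularZero (p.extend η) (Y η)) ∧
    (KrawczykTest F {p.extend s.t} {s.cert.x} s.cert.r s.cert.A c.τ →
      boxNorm (Y s.t - s.cert.x) ≤ s.cert.r)

/-- One test covers the whole time interval with fixed `r` and `A`, so its zeros form a continuous
branch; uniqueness in `XI + rB` joins it to the old branch at the start and to the predicted point
at the end. Continuity of the predictor plays no role. -/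
theorem TrackStep.follows {u v : CVec m} {p : Path u v} {a : CVec n} {s s' : TrackState n}
    (h : TrackStep c F p s s') (hs : s.Follows c F p a) : s'.Follows c F p a := by
  have hτ := c.τ_mem.2
  obtain ⟨ht0, ht1, hh, Y, hYc, hY0, hYr, hYx⟩ := hs
  cases h with
  | step ht s₁ href j h' t' hh' ht' Xp hXp XI hXI htest =>
  have hh'pos : 0 < h' := by
    rw [hh']
    exact mul_pos (pow_pos c.δdec_mem.1 j) (mul_pos (by linarith [c.δinc_gt]) hh)
  have htt' : s.t < t' := by
    rw [ht']; exact lt_min (by linarith) ht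
  have hmemt : s.t ∈ Set.Icc s.t t' := ⟨le_rfl, htt'.le⟩
  have hmemt' : t' ∈ Set.Icc s.t t' := ⟨htt'.le, le_rfl⟩
  obtain ⟨-, hYs₁⟩ := href.invariant (hYr s.t ⟨ht0, le_rfl⟩).eval_eq_zero (hYx href.1)
  have hconv := convex_boxSet XI
  have hx : s₁.x ∈ boxSet XI := hXp ▸ hXI s.t hmemt
  -- The box stays centered at the refined point `s₁.x` throughout; the predicted values matter only
  -- at the final time.
  have hex : ∀ η ∈ Set.Icc s.t t', ∃ y, boxNorm (y - s₁.x) ≤ s₁.r ∧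
      F.eval (p.extend η) y = 0 := fun η hη =>
    htest.existsZero hconv hτ ⟨η, hη, rfl⟩ hx
  choose! Y₂ hY₂x hY₂0 using hex
  have hY₂mem : ∀ η ∈ Set.Icc s.t t', Y₂ η ∈ thicken (boxSet XI) s₁.r := fun η hη =>
    ⟨s₁.x, hx, hY₂x η hη⟩
  have hY₂c : ContinuousOn Y₂ (Set.Icc s.t t') :=
    htest.continuousOn_zero (p.continuous_extend.continuousOn) hconv hτ hY₂mem hY₂0
  have hglue : Y₂ s.t = Y s.t :=
    htest.zero_unique hconv hτ ⟨s.t, hmemt, rfl⟩ (hY₂mem _ hmemt) ⟨s₁.x, hx, hYs₁⟩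
      (hY₂0 _ hmemt) (hYr s.t ⟨ht0, le_rfl⟩).eval_eq_zero
  -- Change of center: the zero near `Xp t'` also lies in `XI + rB`, so it is the one already
  -- followed.
  have hend : boxNorm (Y₂ t' - Xp t') ≤ s₁.r := by
    obtain ⟨y, hy, hy0⟩ := htest.existsZero hconv hτ ⟨t', hmemt', rfl⟩ (hXI t' hmemt')
    rwa [htest.zero_unique hconv hτ ⟨t', hmemt', rfl⟩ (hY₂mem _ hmemt')
      ⟨_, hXI t' hmemt', hy⟩ (hY₂0 _ hmemt') hy0]
  let Y' : ℝ → CVec n := fun η => if η ≤ s.t then Y η else Y₂ η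
  have hY'₁ : ∀ η ∈ Set.Icc 0 s.t, Y' η = Y η := fun η hη => if_pos hη.2
  have hY'₂ : ∀ η ∈ Set.Icc s.t t', Y' η = Y₂ η := by
    intro η hη
    rcases hη.1.eq_or_lt with h | h
    · subst h; simp [Y', hglue]
    · exact if_neg h.not_ge
  have hunion : Set.Icc 0 t' = Set.Icc 0 s.t ∪ Set.Icc s.t t' :=
    (Set.Icc_union_Icc_eq_Icc ht0 htt'.le).symm
  refine ⟨ht0.trans htt'.le, ht' ▸ min_le_right _ _, hh'pos, Y', ?_, ?_, ?_, fun _ => ?_⟩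
  · change ContinuousOn Y' (Set.Icc 0 t')
    rw [hunion]
    exact (hYc.congr hY'₁).union_of_isClosed (hY₂c.congr hY'₂) isClosed_Icc isClosed_Icc
  · rw [hY'₁ 0 ⟨le_rfl, ht0⟩, hY0]
  · intro η hη
    change η ∈ Set.Icc 0 t' at hη
    rw [hunion] at hη
    rcases hη with hη | hη
    · rw [hY'₁ η hη]; exact hYr η hη
    · rw [hY'₂ η hη]
      exact htest.regularZero hτ ⟨η, hη, rfl⟩ (hY₂mem η hη) (hY₂0 η hη)
  · change boxNorm (Y' t' - Xp t') ≤ s₁.r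
    rwa [hY'₂ t' hmemt']

/-- A lift of `p` through regular zeros of `F`. -/
def IsRegularLift (F : SquareSystem m n) {u v : CVec m} (p : Path u v)
    (Γ : unitInterval → CVec n) : Prop :=
  Continuous Γ ∧ ∀ t, F.RegularZero (p t) (Γ t)

theorem Tracked.exists_isRegularLift {u v : CVec m} {p : Path u v} {a b : CVec n}
    (h : Tracked c F p a b) : ∃ Γ, IsRegularLift F p Γ ∧ Γ 0 = a ∧ Γ 1 = b := by
  have hτ := c.τ_mem.2
  have hρ := c.ρ_lt_one
  obtain ⟨x, r₀, A₀, h, r, out, ⟨hK, ha0, ha⟩, ⟨hh, hr, s, hsteps, hs1, href⟩, hKb, hb0, hb⟩ := h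
  have hstart : TrackState.Follows c F p a ⟨0, h, ⟨x, r, (F.jac u x)⁻¹⟩⟩ := by
    refine ⟨le_rfl, zero_le_one, hh.1, fun _ => a, continuousOn_const, rfl, ?_, ?_⟩
    · intro η hη
      have : η = 0 := le_antisymm hη.2 hη.1
      rw [this, p.extend_zero]
      exact hK.regularZero hρ rfl (mem_thicken_singleton ha) ha0
    · intro ht
      simp only [p.extend_zero] at ht
      exact hK.boxNorm_sub_le_of_same_center hρ ht hτ ha0 ha
  have hend : s.Follows c F p a := by
    clear hs1 href
    induction hsteps with
    | refl => exact hstart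
    | tail _ hst ih => exact hst.follows ih
  obtain ⟨-, ht1, -, Y, hYc, hY0, hYr, hYx⟩ := hend
  have hst : s.t = 1 := le_antisymm ht1 (not_lt.1 hs1)
  rw [hst] at hYc hYr hYx
  rw [p.extend_one] at hYx
  have hY1 : F.RegularZero v (Y 1) := by simpa using hYr 1 ⟨zero_le_one, le_rfl⟩
  have hout := href.invariant hY1.eval_eq_zero (hYx href.1)
  refine ⟨fun t => Y t, ⟨?_, fun t => ?_⟩, by simpa using hY0, ?_⟩
  · exact continuousOn_iff_continuous_domRestrict.1 hYc
  · have := hYr t t.2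
    rwa [p.extend_apply t.2] at this
  -- The returned box contains both the endpoint of the branch and `b`.
  · exact hKb.zero_unique (convex_singleton _) hρ rfl (mem_thicken_singleton hout.2)
      (mem_thicken_singleton hb) hY1.eval_eq_zero hb0

end CertMon

namespace CertMon

variable {m n : ℕ}

/-! ## Transport of solutions along paths -/

/-- Some lift of `p` to `X` joins `a` to `b`, every lift that starts at `a` ends at `b`, and every
lift that ends at `b` starts at `a`. -/
structure Transports (X : Set (CVec m × CVec n)) {u v : CVec m} (p : Path u v)
    (a b : CVec n) : Prop where
  exists_lift : ∃ Γ, IsLift X p Γ ∧ Γ 0 = a ∧ Γ 1 = b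
  target_eq : ∀ Γ, IsLift X p Γ → Γ 0 = a → Γ 1 = b
  source_eq : ∀ Γ, IsLift X p Γ → Γ 1 = b → Γ 0 = a

variable {X : Set (CVec m × CVec n)}

theorem IsLift.symm {u v : CVec m} {p : Path u v} {Γ : unitInterval → CVec n}
    (h : IsLift X p Γ) : IsLift X p.symm (fun t => Γ (unitInterval.symm t)) :=
  ⟨h.1.comp unitInterval.continuous_symm, fun t => h.2 (unitInterval.symm t)⟩

theorem IsLift.trans {u v w : CVec m} {p : Path u v} {q : Path v w} {a b c : CVec n}
    {Γ : Path a b} {Δ : Path b c} (hΓ : IsLift X p Γ) (hΔ : IsLift X q Δ) :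
    IsLift X (p.trans q) (Γ.trans Δ) := by
  refine ⟨(Γ.trans Δ).continuous, fun t => ?_⟩
  rw [Path.trans_apply, Path.trans_apply]
  split_ifs
  · exact hΓ.2 _
  · exact hΔ.2 _

theorem IsLift.split {u v w : CVec m} {p : Path u v} {q : Path v w}
    {Γ : unitInterval → CVec n} (h : IsLift X (p.trans q) Γ) :
    ∃ Γ₁ Γ₂, IsLift X p Γ₁ ∧ IsLift X q Γ₂ ∧ Γ₁ 0 = Γ 0 ∧ Γ₁ 1 = Γ₂ 0 ∧ Γ₂ 1 = Γ 1 := by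
  have h1 : ∀ t : unitInterval, (t : ℝ) / 2 ∈ unitInterval := fun t =>
    ⟨by linarith [t.2.1], by linarith [t.2.2]⟩
  have h2 : ∀ t : unitInterval, ((t : ℝ) + 1) / 2 ∈ unitInterval := fun t =>
    ⟨by linarith [t.2.1], by linarith [t.2.2]⟩
  have e1 : ∀ t : unitInterval, p.trans q ⟨(t : ℝ) / 2, h1 t⟩ = p t := by
    intro t
    rw [Path.trans_apply, dif_pos (by linarith [t.2.2] : (t : ℝ) / 2 ≤ 1 / 2)]
    congr 1; ext; simp only; ring
  have e2 : ∀ t : unitInterval, p.trans q ⟨((t : ℝ) + 1) / 2, h2 t⟩ = q t := by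
    intro t
    rw [Path.trans_apply]
    split_ifs with ht
    -- At the junction `1/2`, concatenation uses its first branch; both halves give the common
    -- endpoint there.
    · have h0 : (t : ℝ) = 0 := by
        have := t.2.1
        simp only at ht
        linarith
      have h0' : t = 0 := Subtype.ext h0
      subst h0'
      rw [q.source]
      convert p.target
      simp
    · congr 1; ext; simp only; ring
  refine ⟨fun t => Γ ⟨(t : ℝ) / 2, h1 t⟩, fun t => Γ ⟨((t : ℝ) + 1) / 2, h2 t⟩,
    ⟨h.1.comp (by fun_prop), fun t => ?_⟩, ⟨h.1.comp (by fun_prop), fun t => ?_⟩, ?_, ?_, ?_⟩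
  · have := h.2 ⟨(t : ℝ) / 2, h1 t⟩
    rwa [e1] at this
  · have := h.2 ⟨((t : ℝ) + 1) / 2, h2 t⟩
    rwa [e2] at this
  · simp only; congr; simp
  · simp only; congr 2; simp
  · simp only; congr; norm_num

namespace Transports

/-- A lift of a constant path stays in one finite, hence discrete, fiber, so it is constant. -/
theorem refl {u : CVec m} (hfin : (fiber X u).Finite) {a : CVec n} (ha : a ∈ fiber X u) :
    Transports X (Path.refl u) a a := by
  have hconst : ∀ Γ, IsLift X (Path.refl u) Γ → Γ 0 = Γ 1 := by
    intro Γ hΓ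
    exact isPreconnected_univ.constant_of_mapsTo hfin.isDiscrete hΓ.1.continuousOn
      (fun t _ => (hΓ.2 t : Γ t ∈ fiber X u)) (Set.mem_univ 0) (Set.mem_univ 1)
  exact ⟨⟨fun _ => a, ⟨continuous_const, fun _ => ha⟩, rfl, rfl⟩,
    fun Γ h h0 => (hconst Γ h).symm.trans h0, fun Γ h h1 => (hconst Γ h).trans h1⟩

theorem symm {u v : CVec m} {p : Path u v} {a b : CVec n} (h : Transports X p a b) :
    Transports X p.symm b a := by
  obtain ⟨⟨Γ, hΓ, h0, h1⟩, ht, hs⟩ := h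
  refine ⟨⟨_, hΓ.symm, by simpa, by simpa⟩, fun Δ hΔ hb => ?_, fun Δ hΔ ha => ?_⟩
  · have := hs _ (by simpa using hΔ.symm) (by simpa using hb)
    simpa using this
  · have := ht _ (by simpa using hΔ.symm) (by simpa using ha)
    simpa using this

theorem trans {u v w : CVec m} {p : Path u v} {q : Path v w} {a b c : CVec n}
    (h : Transports X p a b) (h' : Transports X q b c) : Transports X (p.trans q) a c := by
  refine ⟨?_, fun Γ hΓ h0 => ?_, fun Γ hΓ h1 => ?_⟩
  · obtain ⟨Γ, hΓ, h0, h1⟩ := h.exists_lift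
    obtain ⟨Δ, hΔ, h0', h1'⟩ := h'.exists_lift
    let Γ' : Path a b := ⟨⟨Γ, hΓ.1⟩, h0, h1⟩
    let Δ' : Path b c := ⟨⟨Δ, hΔ.1⟩, h0', h1'⟩
    exact ⟨Γ'.trans Δ', IsLift.trans (Γ := Γ') (Δ := Δ') hΓ hΔ, Path.source _, Path.target _⟩
  · obtain ⟨Γ₁, Γ₂, h1, h2, e0, em, e1⟩ := hΓ.split
    rw [← e1]
    exact h'.target_eq _ h2 (em ▸ h.target_eq _ h1 (e0.trans h0))
  · obtain ⟨Γ₁, Γ₂, h1', h2, e0, em, e1⟩ := hΓ.split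
    rw [← e0]
    exact h.source_eq _ h1' (em.trans (h'.source_eq _ h2 (e1.trans h1)))

theorem source_mem {u v : CVec m} {p : Path u v} {a b : CVec n} (h : Transports X p a b) :
    a ∈ fiber X u := by
  obtain ⟨Γ, hΓ, rfl, -⟩ := h.exists_lift
  simpa [fiber] using hΓ.2 0

theorem target_mem {u v : CVec m} {p : Path u v} {a b : CVec n} (h : Transports X p a b) :
    b ∈ fiber X v := by
  obtain ⟨Γ, hΓ, -, rfl⟩ := h.exists_lift
  simpa [fiber] using hΓ.2 1

theorem target_unique {u v : CVec m} {p : Path u v} {a b b' : CVec n}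
    (h : Transports X p a b) (h' : Transports X p a b') : b = b' := by
  obtain ⟨Γ, hΓ, h0, h1⟩ := h.exists_lift
  rw [← h1, h'.target_eq Γ hΓ h0]

theorem source_unique {u v : CVec m} {p : Path u v} {a a' b : CVec n}
    (h : Transports X p a b) (h' : Transports X p a' b) : a = a' :=
  h.symm.target_unique h'.symm

end Transports

/-! ### Regular lifts as unique lifts to the variety -/

section RegularLift

variable {F : SquareSystem m n} {P : Set (ParamPoly m n)} {u v : CVec m} {p : Path u v}
  {Γ : unitInterval → CVec n}

/-- A regular lift that starts on `X` stays on `X`. -/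
theorem IsRegularLift.isLift (hF : F.LocallyDefines (solutionVariety P))
    (h : IsRegularLift F p Γ) (h0 : Γ 0 ∈ fiber (solutionVariety P) u) :
    IsLift (solutionVariety P) p Γ := by
  have hc : Continuous fun t => (p t, Γ t) := p.continuous.prodMk h.1
  -- Closed because `X` is closed; open because zeros near a regular zero on `X` are again on `X`.
  have hclopen : IsClopen {t | (p t, Γ t) ∈ solutionVariety P} := by
    refine ⟨(isClosed_solutionVariety P).preimage hc, isOpen_iff_mem_nhds.2 fun t ht => ?_⟩
    filter_upwards [hc.continuousAt.eventually (hF.eventually_mem (h.2 t) ht)] with t' ht'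
    exact ht' (h.2 t').eval_eq_zero
  have huniv := hclopen.eq_univ ⟨0, by simpa [fiber] using h0⟩
  exact ⟨h.1, fun t => (huniv ▸ Set.mem_univ t :)⟩

/-- A lift to `X` that meets a regular lift coincides with it. -/
theorem IsRegularLift.eq_of_isLift (hF : F.LocallyDefines (solutionVariety P))
    (h : IsRegularLift F p Γ) {Δ : unitInterval → CVec n} (hΔ : IsLift (solutionVariety P) p Δ)
    {t₀ : unitInterval} (h0 : Γ t₀ = Δ t₀) : Γ = Δ := by
  have hcΓ : Continuous fun t => (p t, Γ t) := p.continuous.prodMk h.1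
  have hcΔ : Continuous fun t => (p t, Δ t) := p.continuous.prodMk hΔ.1
  -- For openness, near an agreement time points of `Δ` are zeros of `F`, since they lie on `X`, and
  -- a regular zero has no second zero nearby over the same parameter.
  have hclopen : IsClopen {t | Γ t = Δ t} := by
    refine ⟨isClosed_eq h.1 hΔ.1, isOpen_iff_mem_nhds.2 fun t ht => ?_⟩
    have ht : Γ t = Δ t := ht
    obtain ⟨U, hU, huniq⟩ := (h.2 t).eventually_unique
    have hz := hF.eventually_eval_eq_zero (q := (p t, Γ t)) (h.2 t).definedAt
    have hlim : Filter.Tendsto (fun t => (p t, Δ t)) (𝓝 t) (𝓝 (p t, Γ t)) := by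
      rw [ht]; exact hcΔ.continuousAt
    filter_upwards [hcΓ.continuousAt.eventually_mem hU, hlim.eventually_mem hU,
      hlim.eventually hz] with t' h1 h2 h3
    exact huniq _ _ _ h1 h2 (h.2 t').eval_eq_zero (h3 (hΔ.2 t'))
  have huniv := hclopen.eq_univ ⟨t₀, h0⟩
  exact funext fun t => (huniv ▸ Set.mem_univ t :)

theorem IsRegularLift.transports (hF : F.LocallyDefines (solutionVariety P))
    (h : IsRegularLift F p Γ) (h0 : Γ 0 ∈ fiber (solutionVariety P) u) :
    Transports (solutionVariety P) p (Γ 0) (Γ 1) :=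
  ⟨⟨Γ, h.isLift hF h0, rfl, rfl⟩, fun _ hΔ e => by rw [h.eq_of_isLift hF hΔ e.symm],
    fun _ hΔ e => by rw [h.eq_of_isLift hF hΔ e.symm]⟩

theorem Tracked.transports {c : TrackConstants} (hF : F.LocallyDefines (solutionVariety P))
    {a b : CVec n} (h : Tracked c F p a b) (ha : a ∈ fiber (solutionVariety P) u) :
    Transports (solutionVariety P) p a b := by
  obtain ⟨Γ, hΓ, rfl, rfl⟩ := h.exists_isRegularLift
  exact hΓ.transports hF ha

end RegularLift

end CertMon

namespace CertMon

variable {m n : ℕ}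

/-! ## Walks, spanning trees and the group generated by the fundamental cycles -/

namespace HomotopyGraph

variable {V E : Type*} {G : HomotopyGraph m V E}

namespace Walk

/-- Concatenation of walks. -/
def append : {u v w : V} → G.Walk u v → G.Walk v w → G.Walk u w
  | _, _, _, nil _, W' => W'
  | _, _, _, fwd e W, W' => fwd e (append W W')
  | _, _, _, bwd e W, W' => bwd e (append W W')

/-- The walk traversed backwards. -/
def reverse : {u v : V} → G.Walk u v → G.Walk v u
  | _, _, nil v => nil v
  | _, _, fwd e W => (reverse W).append (bwd e (nil _))
  | _, _, bwd e W => (reverse W).append (fwd e (nil _))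

theorem edges_append {u v w : V} (W : G.Walk u v) (W' : G.Walk v w) :
    (W.append W').edges = W.edges ++ W'.edges := by
  induction W with
  | nil => rfl
  | fwd e W ih => simp [append, edges, ih]
  | bwd e W ih => simp [append, edges, ih]

theorem mem_edges_reverse {u v : V} (W : G.Walk u v) (e : E) :
    e ∈ W.reverse.edges ↔ e ∈ W.edges := by
  induction W with
  | nil => rfl
  | fwd e' W ih => simp [reverse, edges, edges_append, ih, or_comm]
  | bwd e' W ih => simp [reverse, edges, edges_append, ih, or_comm]

variable {K : V → Set (CVec n)} (γ : ∀ e, K (G.src e) ≃ K (G.tgt e))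

theorem transport_append {u v w : V} (W : G.Walk u v) (W' : G.Walk v w) :
    (W.append W').transport γ = (W.transport γ).trans (W'.transport γ) := by
  induction W with
  | nil => rfl
  | fwd e W ih => simp [append, transport, ih, Equiv.trans_assoc]
  | bwd e W ih => simp [append, transport, ih, Equiv.trans_assoc]

theorem transport_reverse {u v : V} (W : G.Walk u v) :
    W.reverse.transport γ = (W.transport γ).symm := by
  induction W with
  | nil => rfl
  | fwd e W ih => simp only [reverse, transport_append, transport, ih]; rfl
  | bwd e W ih => simp only [reverse, transport_append, transport, ih]; rfl

theorem transport_of_edges_eq_nil {u : V} (W : G.Walk u u) (h : W.edges = []) :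
    W.transport γ = Equiv.refl _ := by
  -- Freeing the two end vertices permits case analysis on the walk. The claim then compares
  -- vectors, since `K v` and `K w` are different types.
  suffices H : ∀ {v w : V} (W : G.Walk v w), W.edges = [] →
      ∃ h : v = w, ∀ a : K v, (W.transport γ a : CVec n) = a by
    obtain ⟨-, h'⟩ := H W h
    exact Equiv.ext fun a => Subtype.ext (h' a)
  intro v w W h
  cases W with
  | nil => exact ⟨rfl, fun _ => rfl⟩
  | fwd e W => simp [edges] at h
  | bwd e W => simp [edges] at h

/-- A walk through an edge splits at the edge. -/
theorem exists_split {u v : V} (W : G.Walk u v) {e : E} (he : e ∈ W.edges) :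
    (∃ (W₁ : G.Walk u (G.src e)) (W₂ : G.Walk (G.tgt e) v), W = W₁.append (fwd e W₂)) ∨
    (∃ (W₁ : G.Walk u (G.tgt e)) (W₂ : G.Walk (G.src e) v), W = W₁.append (bwd e W₂)) := by
  induction W with
  | nil => simp [edges] at he
  | fwd e' W ih =>
    by_cases h : e = e'
    · subst h; exact Or.inl ⟨nil _, W, rfl⟩
    · rcases ih (by simpa [edges, h] using he) with ⟨W₁, W₂, rfl⟩ | ⟨W₁, W₂, rfl⟩
      · exact Or.inl ⟨fwd e' W₁, W₂, rfl⟩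
      · exact Or.inr ⟨fwd e' W₁, W₂, rfl⟩
  | bwd e' W ih =>
    by_cases h : e = e'
    · subst h; exact Or.inr ⟨nil _, W, rfl⟩
    · rcases ih (by simpa [edges, h] using he) with ⟨W₁, W₂, rfl⟩ | ⟨W₁, W₂, rfl⟩
      · exact Or.inl ⟨bwd e' W₁, W₂, rfl⟩
      · exact Or.inr ⟨bwd e' W₁, W₂, rfl⟩

/-- The part of a walk after a visit to `x`. -/
theorem exists_drop {u v x : V} (W : G.Walk u v) (hx : x ∈ W.verts) :
    ∃ W' : G.Walk x v, W'.edges ⊆ W.edges ∧ W'.verts.Sublist W.verts := by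
  induction W with
  | nil w =>
    obtain rfl : x = w := by simpa [verts] using hx
    exact ⟨nil _, fun _ h => h, List.Sublist.refl _⟩
  | fwd e W ih =>
    by_cases h : x = G.src e
    · subst h; exact ⟨fwd e W, fun _ h => h, List.Sublist.refl _⟩
    · obtain ⟨W', h1, h2⟩ := ih (by simpa [verts, h] using hx)
      exact ⟨W', fun _ h => List.mem_cons_of_mem _ (h1 h), h2.cons _⟩
  | bwd e W ih =>
    by_cases h : x = G.tgt e
    · subst h; exact ⟨bwd e W, fun _ h => h, List.Sublist.refl _⟩
    · obtain ⟨W', h1, h2⟩ := ih (by simpa [verts, h] using hx)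
      exact ⟨W', fun _ h => List.mem_cons_of_mem _ (h1 h), h2.cons _⟩

/-- Whenever the first vertex reappears, the excursion before its reappearance is cut off. -/
theorem exists_verts_nodup {u v : V} (W : G.Walk u v) :
    ∃ W' : G.Walk u v, W'.edges ⊆ W.edges ∧ W'.verts.Nodup := by
  induction W with
  | nil w => exact ⟨nil w, fun _ h => h, by simp [verts]⟩
  | fwd e W ih =>
    obtain ⟨W', h1, h2⟩ := ih
    by_cases h : G.src e ∈ W'.verts
    · obtain ⟨W'', h3, h4⟩ := W'.exists_drop h
      exact ⟨W'', fun _ h => List.mem_cons_of_mem _ (h1 (h3 h)), h4.nodup h2⟩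
    · exact ⟨fwd e W', List.cons_subset_cons _ h1, List.nodup_cons.2 ⟨h, h2⟩⟩
  | bwd e W ih =>
    obtain ⟨W', h1, h2⟩ := ih
    by_cases h : G.tgt e ∈ W'.verts
    · obtain ⟨W'', h3, h4⟩ := W'.exists_drop h
      exact ⟨W'', fun _ h => List.mem_cons_of_mem _ (h1 (h3 h)), h4.nodup h2⟩
    · exact ⟨bwd e W', List.cons_subset_cons _ h1, List.nodup_cons.2 ⟨h, h2⟩⟩

end Walk

variable {K : V → Set (CVec n)} (γ : ∀ e, K (G.src e) ≃ K (G.tgt e)) {T : Set E}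

namespace IsSpanningTree

theorem exists_isPathIn (hT : G.IsSpanningTree T) (u v : V) :
    ∃ W : G.Walk u v, G.IsPathIn T W := by
  obtain ⟨W, hW⟩ := hT.1 u v
  obtain ⟨W', h1, h2⟩ := W.exists_verts_nodup
  exact ⟨W', fun e he => hW e (h1 he), h2⟩

/-- Backtracking can be removed from a walk in a tree without changing the transport. -/
theorem exists_edges_nodup (hT : G.IsSpanningTree T) {u v : V} (W : G.Walk u v)
    (hW : ∀ e ∈ W.edges, e ∈ T) :
    ∃ W' : G.Walk u v, (∀ e ∈ W'.edges, e ∈ T) ∧ W'.edges.Nodup ∧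
      W'.transport γ = W.transport γ := by
  induction W with
  | nil w => exact ⟨.nil w, hW, by simp [Walk.edges], rfl⟩
  | fwd e W ih =>
    have heT : e ∈ T := hW e (by simp [Walk.edges])
    obtain ⟨W', h1, h2, h3⟩ := ih fun e' he' => hW e' (List.mem_cons_of_mem _ he')
    by_cases h : e ∈ W'.edges
    · rcases W'.exists_split h with ⟨W₁, W₂, rfl⟩ | ⟨W₁, W₂, rfl⟩
      all_goals
        simp only [Walk.edges_append, Walk.edges, List.mem_append, List.mem_cons] at h1 h2
        rw [List.nodup_append] at h2
      -- A second traversal of `e` in the same direction would close up a nonempty circuit in the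
      -- tree.
      · have := hT.2 _ (.fwd e W₁)
          (by simpa [Walk.edges] using ⟨heT, fun e' he' => h1 e' (Or.inl he')⟩)
          (List.nodup_cons.2 ⟨fun hmem => h2.2.2 e hmem e (by simp) rfl, h2.1⟩)
        simp [Walk.edges] at this
      -- If `e` returns in the opposite direction, the part in between is an edge-simple closed
      -- walk, hence empty, and the two traversals cancel.
      · refine ⟨W₂, fun e' he' => h1 e' (Or.inr (Or.inr he')), (List.nodup_cons.1 h2.2.1).2, ?_⟩
        have hnil := hT.2 _ W₁ (fun e' he' => h1 e' (Or.inl he')) h2.1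
        simp only [Walk.transport, ← h3, Walk.transport_append,
          Walk.transport_of_edges_eq_nil γ W₁ hnil]
        ext a; simp
    · refine ⟨.fwd e W', by simpa [Walk.edges] using ⟨heT, h1⟩, List.nodup_cons.2 ⟨h, h2⟩, ?_⟩
      simp [Walk.transport, h3]
  | bwd e W ih =>
    have heT : e ∈ T := hW e (by simp [Walk.edges])
    obtain ⟨W', h1, h2, h3⟩ := ih fun e' he' => hW e' (List.mem_cons_of_mem _ he')
    by_cases h : e ∈ W'.edges
    · rcases W'.exists_split h with ⟨W₁, W₂, rfl⟩ | ⟨W₁, W₂, rfl⟩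
      all_goals
        simp only [Walk.edges_append, Walk.edges, List.mem_append, List.mem_cons] at h1 h2
        rw [List.nodup_append] at h2
      · refine ⟨W₂, fun e' he' => h1 e' (Or.inr (Or.inr he')), (List.nodup_cons.1 h2.2.1).2, ?_⟩
        have hnil := hT.2 _ W₁ (fun e' he' => h1 e' (Or.inl he')) h2.1
        simp only [Walk.transport, ← h3, Walk.transport_append,
          Walk.transport_of_edges_eq_nil γ W₁ hnil]
        ext a; simp
      · have := hT.2 _ (.bwd e W₁)
          (by simpa [Walk.edges] using ⟨heT, fun e' he' => h1 e' (Or.inl he')⟩)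
          (List.nodup_cons.2 ⟨fun hmem => h2.2.2 e hmem e (by simp) rfl, h2.1⟩)
        simp [Walk.edges] at this
    · refine ⟨.bwd e W', by simpa [Walk.edges] using ⟨heT, h1⟩, List.nodup_cons.2 ⟨h, h2⟩, ?_⟩
      simp [Walk.transport, h3]

/-- Closed walks in a tree have trivial transport. -/
theorem transport_eq_refl (hT : G.IsSpanningTree T) {u : V} (W : G.Walk u u)
    (hW : ∀ e ∈ W.edges, e ∈ T) : W.transport γ = Equiv.refl _ := by
  obtain ⟨W', h1, h2, h3⟩ := hT.exists_edges_nodup γ W hW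
  rw [← h3]
  exact Walk.transport_of_edges_eq_nil γ W' (hT.2 u W' h1 h2)

/-- The transports along closed walks are generated by the fundamental cycles of a tree. -/
theorem transport_mem_closure (hT : G.IsSpanningTree T) {z₀ : V} (W : G.Walk z₀ z₀) :
    (W.transport γ : Equiv.Perm (K z₀)) ∈
      Subgroup.closure (G.monodromyGenerators γ z₀ T) := by
  choose R hR using hT.exists_isPathIn z₀
  -- Closing up an edge by tree paths from `z₀` gives a generator, or the identity when the edge
  -- lies in the tree.
  have hedge : ∀ e, (((R (G.src e)).transport γ).trans (γ e)).trans
      ((R (G.tgt e)).transport γ).symm ∈ Subgroup.closure (G.monodromyGenerators γ z₀ T) := by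
    intro e
    by_cases he : e ∈ T
    · have h := hT.transport_eq_refl γ
        ((R (G.src e)).append (.fwd e (R (G.tgt e)).reverse)) (by
          intro e' he'
          simp only [Walk.edges_append, Walk.edges, List.mem_append, List.mem_cons,
            Walk.mem_edges_reverse] at he'
          rcases he' with h | rfl | h
          · exact (hR _).1 _ h
          · exact he
          · exact (hR _).1 _ h)
      simp only [Walk.transport_append, Walk.transport, Walk.transport_reverse] at h
      rw [Equiv.trans_assoc, h]
      exact Subgroup.one_mem _
    · exact Subgroup.subset_closure ⟨e, he, _, _, hR _, hR _, rfl⟩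
  -- Telescoping: inserting tree paths to `z₀` and back at every vertex writes the transport as a
  -- product of closed-up edges and their inverses.
  have key : ∀ {u v : V} (W : G.Walk u v), (((R u).transport γ).trans (W.transport γ)).trans
      ((R v).transport γ).symm ∈ Subgroup.closure (G.monodromyGenerators γ z₀ T) := by
    intro u v W
    induction W with
    | nil v =>
      convert Subgroup.one_mem _
      ext a; simp [Walk.transport]
    | fwd e W ih =>
      convert Subgroup.mul_mem _ ih (hedge e) using 1
      ext a; simp [Walk.transport]
    | bwd e W ih =>
      convert Subgroup.mul_mem _ ih (Subgroup.inv_mem _ (hedge e)) using 1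
      ext a; simp [Walk.transport, Equiv.Perm.inv_def]
  -- The chosen tree path from `z₀` to itself acts trivially, so the conjugation disappears.
  have h0 := hT.transport_eq_refl γ (R z₀) (hR z₀).1
  simpa [h0] using key W

end IsSpanningTree

end HomotopyGraph

end CertMon

namespace CertMon

variable {m n : ℕ}

/-! ## Walks and monodromy -/

theorem finite_fiber_of_notMem_discriminant {X : Set (CVec m × CVec n)} {d : ℕ} {z : CVec m}
    (hz : z ∉ discriminant X d) : (fiber X z).Finite :=
  Set.finite_of_encard_eq_coe (not_not.1 hz)

theorem notMem_of_trans {D : Set (CVec m)} {u v w : CVec m} {p : Path u v} {q : Path v w}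
    (hp : ∀ t, p t ∉ D) (hq : ∀ t, q t ∉ D) (t : unitInterval) : p.trans q t ∉ D := by
  rw [Path.trans_apply]
  split_ifs
  · exact hp _
  · exact hq _

theorem Induces.unique {X : Set (CVec m × CVec n)} {z : CVec m} {ℓ : Path z z}
    {K : Set (CVec n)} {σ σ' : Equiv.Perm K} (h : Induces X ℓ σ) (h' : Induces X ℓ σ') :
    σ = σ' := by
  ext a
  obtain ⟨Γ, hΓ, h0⟩ := (h a).1
  rw [← (h a).2 Γ hΓ h0, (h' a).2 Γ hΓ h0]

namespace HomotopyGraph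

variable {V E : Type*} {G : HomotopyGraph m V E} {X : Set (CVec m × CVec n)} {d : ℕ}

theorem AvoidsDiscriminant.toPath_notMem (hG : G.AvoidsDiscriminant X d) {u v : V}
    (W : G.Walk u v) (t : unitInterval) : W.toPath t ∉ discriminant X d := by
  induction W generalizing t with
  | nil v => exact hG.1 v
  | fwd e W ih => exact notMem_of_trans (hG.2 e) ih t
  | bwd e W ih => exact notMem_of_trans (fun t => hG.2 e (unitInterval.symm t)) ih t

variable {K : V → Set (CVec n)} {γ : ∀ e, K (G.src e) ≃ K (G.tgt e)}

theorem Walk.transports (hG : G.AvoidsDiscriminant X d) (hK : ∀ v, K v ⊆ fiber X (G.pos v))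
    (hγ : ∀ e (a : K (G.src e)), Transports X (G.path e) a (γ e a)) {u v : V}
    (W : G.Walk u v) (a : K u) :
    Transports X W.toPath a (W.transport γ a) := by
  induction W with
  | nil v => exact Transports.refl (finite_fiber_of_notMem_discriminant (hG.1 v)) (hK v a.2)
  | fwd e W ih => exact (hγ e a).trans (ih _)
  | bwd e W ih =>
    have h := (hγ e ((γ e).symm a)).symm
    rw [Equiv.apply_symm_apply] at h
    exact h.trans (ih _)

theorem Walk.induces_transport (hG : G.AvoidsDiscriminant X d)
    (hK : ∀ v, K v ⊆ fiber X (G.pos v))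
    (hγ : ∀ e (a : K (G.src e)), Transports X (G.path e) a (γ e a)) {z₀ : V}
    (W : G.Walk z₀ z₀) : Induces X W.toPath (W.transport γ : Equiv.Perm (K z₀)) := by
  intro a
  have h := W.transports hG hK hγ a
  obtain ⟨Γ, hΓ, h0, -⟩ := h.exists_lift
  exact ⟨⟨Γ, hΓ, h0⟩, h.target_eq⟩

theorem exists_walk_of_mem_monodromyGenerators {z₀ : V} {T : Set E} {σ : Equiv.Perm (K z₀)}
    (hσ : σ ∈ G.monodromyGenerators γ z₀ T) : ∃ W : G.Walk z₀ z₀, σ = W.transport γ := by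
  obtain ⟨e, -, P, Q, -, -, rfl⟩ := hσ
  refine ⟨P.append (.fwd e Q.reverse), ?_⟩
  rw [Walk.transport_append, Walk.transport, Walk.transport_reverse, Equiv.trans_assoc]

/-- Each generator is the transport around a closed walk. Conversely, a loop induces at most one
permutation, so anything induced by a closed walk is its transport, which the fundamental cycles
generate. -/
theorem closure_monodromyGenerators (hG : G.AvoidsDiscriminant X d)
    (hK : ∀ v, K v ⊆ fiber X (G.pos v))
    (hγ : ∀ e (a : K (G.src e)), Transports X (G.path e) a (γ e a)) {z₀ : V}
    {T : Set E} (hT : G.IsSpanningTree T) :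
    Subgroup.closure (G.monodromyGenerators γ z₀ T) = graphMonodromyGroup X G z₀ (K z₀) := by
  refine le_antisymm (Subgroup.closure_mono fun σ hσ => ?_) ((Subgroup.closure_le _).2 ?_)
  · obtain ⟨W, rfl⟩ := exists_walk_of_mem_monodromyGenerators hσ
    exact ⟨W, W.induces_transport hG hK hγ⟩
  · rintro σ ⟨W, hW⟩
    rw [hW.unique (W.induces_transport hG hK hγ)]
    exact hT.transport_mem_closure γ W

end HomotopyGraph

theorem map_permCongrHom_graphMonodromyGroup {V E : Type*} (X : Set (CVec m × CVec n))
    (G : HomotopyGraph m V E) (z₀ : V) {K K' : Set (CVec n)} (h : K = K') :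
    (graphMonodromyGroup X G z₀ K).map (Equiv.permCongrHom (Equiv.setCongr h)).toMonoidHom =
      graphMonodromyGroup X G z₀ K' := by
  subst h
  convert Subgroup.map_id _
  ext σ a
  rfl

theorem graphMonodromyGroup_le {V E : Type*} {X : Set (CVec m × CVec n)} {d : ℕ}
    {G : HomotopyGraph m V E} (hG : G.AvoidsDiscriminant X d) (z₀ : V) :
    graphMonodromyGroup X G z₀ (fiber X (G.pos z₀)) ≤ monodromyGroup X d (G.pos z₀) :=
  Subgroup.closure_mono fun _ ⟨W, hW⟩ => ⟨W.toPath, hG.toPath_notMem W, hW⟩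

/-! ## Invariants of the computation -/

namespace CompState

variable {V E : Type*} {G : HomotopyGraph m V E}

/-- Two solutions over the ends of an edge are paired at that edge. -/
inductive Recorded (G : HomotopyGraph m V E) (s : CompState n V E) :
    V × CVec n → V × CVec n → Prop
  | fwd {e : E} {a b : CVec n} (h : (a, b) ∈ s.corr e) : Recorded G s (G.src e, a) (G.tgt e, b)
  | bwd {e : E} {a b : CVec n} (h : (a, b) ∈ s.corr e) : Recorded G s (G.tgt e, b) (G.src e, a)

/-- The recorded pairs are pairs of known solutions that are joined by lifts, and every known
solution lies over its vertex and is reached from `x₀` along recorded pairs. -/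
structure Sound (X : Set (CVec m × CVec n)) (G : HomotopyGraph m V E) (z₀ : V) (x₀ : CVec n)
    (s : CompState n V E) : Prop where
  corr_mem : ∀ e a b, (a, b) ∈ s.corr e →
    a ∈ s.known (G.src e) ∧ b ∈ s.known (G.tgt e) ∧ Transports X (G.path e) a b
  known_subset : ∀ v, s.known v ⊆ fiber X (G.pos v)
  base_mem : x₀ ∈ s.known z₀
  reached : ∀ v, ∀ a ∈ s.known v, Relation.ReflTransGen (s.Recorded G) (z₀, x₀) (v, a)

theorem mem_known_record {s : CompState n V E} {v w : V} {N : Set (CVec n)} {e : E}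
    {R : Set (CVec n × CVec n)} {a : CVec n} :
    a ∈ (s.record v N e R).known w ↔ a ∈ s.known w ∨ w = v ∧ a ∈ N := by
  by_cases h : w = v
  · subst h; simp [record]
  · simp [record, h]

theorem mem_corr_record {s : CompState n V E} {v : V} {N : Set (CVec n)} {e e' : E}
    {R : Set (CVec n × CVec n)} {q : CVec n × CVec n} :
    q ∈ (s.record v N e R).corr e' ↔ q ∈ s.corr e' ∨ e' = e ∧ q ∈ R := by
  by_cases h : e' = e
  · subst h; simp [record]
  · simp [record, h]

variable {X : Set (CVec m × CVec n)} {z₀ : V} {x₀ : CVec n}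

theorem sound_init (hx₀ : x₀ ∈ fiber X (G.pos z₀)) :
    (init z₀ x₀ : CompState n V E).Sound X G z₀ x₀ := by
  have hmem : ∀ v a, a ∈ (init z₀ x₀ : CompState n V E).known v ↔ v = z₀ ∧ a = x₀ := by
    intro v a
    by_cases h : v = z₀
    · subst h; simp [init]
    · simp [init, h]
  refine ⟨fun e a b h => h.elim, fun v a ha => ?_, (hmem _ _).2 ⟨rfl, rfl⟩, fun v a ha => ?_⟩
  · obtain ⟨rfl, rfl⟩ := (hmem _ _).1 ha
    exact hx₀
  · obtain ⟨rfl, rfl⟩ := (hmem _ _).1 ha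
    exact .refl

/-- Common to both directions of an edge step: each new solution must lie in its fiber and be
attached by one recorded pair to a previously known solution, which extends the chain from `x₀`. -/
theorem Sound.record {s : CompState n V E} (h : s.Sound X G z₀ x₀) {v : V} {N : Set (CVec n)}
    {e : E} {R : Set (CVec n × CVec n)}
    (hR : ∀ a b, (a, b) ∈ R → a ∈ (s.record v N e R).known (G.src e) ∧
      b ∈ (s.record v N e R).known (G.tgt e) ∧ Transports X (G.path e) a b)
    (hN : ∀ b ∈ N, b ∈ fiber X (G.pos v) ∧
      ∃ w, ∃ a ∈ s.known w, (s.record v N e R).Recorded G (w, a) (v, b)) :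
    (s.record v N e R).Sound X G z₀ x₀ := by
  have hmono : ∀ p q, s.Recorded G p q → (s.record v N e R).Recorded G p q := by
    rintro _ _ (h | h)
    · exact .fwd (mem_corr_record.2 (Or.inl h))
    · exact .bwd (mem_corr_record.2 (Or.inl h))
  refine ⟨fun e' a b hab => ?_, fun w a ha => ?_, mem_known_record.2 (Or.inl h.base_mem),
    fun w a ha => ?_⟩
  · rcases mem_corr_record.1 hab with hab' | ⟨rfl, hab'⟩
    · obtain ⟨h1, h2, h3⟩ := h.corr_mem e' a b hab'
      exact ⟨mem_known_record.2 (Or.inl h1), mem_known_record.2 (Or.inl h2), h3⟩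
    · exact hR a b hab'
  · rcases mem_known_record.1 ha with ha' | ⟨rfl, ha'⟩
    · exact h.known_subset w ha'
    · exact (hN a ha').1
  · rcases mem_known_record.1 ha with ha' | ⟨rfl, ha'⟩
    · exact Relation.ReflTransGen.mono hmono _ _ (h.reached w a ha')
    · obtain ⟨-, w', b, hb, hrec⟩ := hN a ha'
      exact (Relation.ReflTransGen.mono hmono _ _ (h.reached w' b hb)).tail hrec

theorem Step.sound {P : Set (ParamPoly m n)} {F : SquareSystem m n}
    (hF : F.LocallyDefines (solutionVariety P)) {c : TrackConstants} {s s' : CompState n V E}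
    (hstep : Step c F G s s') (h : s.Sound (solutionVariety P) G z₀ x₀) :
    s'.Sound (solutionVariety P) G z₀ x₀ := by
  cases hstep with
  | fwd e he f hf =>
    have ht : ∀ a ∈ s.known (G.src e), Transports (solutionVariety P) (G.path e) a (f a) :=
      fun a ha => (hf a ha).transports hF (h.known_subset _ ha)
    refine h.record ?_ ?_
    · rintro a₁ b₁ ⟨a, ha, h⟩
      obtain ⟨rfl, rfl⟩ := Prod.mk.inj h
      exact ⟨mem_known_record.2 (Or.inl ha), mem_known_record.2 (Or.inr ⟨rfl, a, ha, rfl⟩), ht a ha⟩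
    · rintro _ ⟨a, ha, rfl⟩
      exact ⟨(ht a ha).target_mem, _, a, ha, .fwd (mem_corr_record.2 (Or.inr ⟨rfl, a, ha, rfl⟩))⟩
  | bwd e he f hf =>
    have ht : ∀ b ∈ s.known (G.tgt e), Transports (solutionVariety P) (G.path e) (f b) b := by
      intro b hb
      -- Tracking ran along the reversed path; the symmetry of `Transports` turns the result into a
      -- statement about the edge's own orientation.
      simpa using ((hf b hb).transports hF (h.known_subset _ hb)).symm
    refine h.record ?_ ?_
    · rintro a₁ b₁ ⟨b, hb, h⟩
      obtain ⟨rfl, rfl⟩ := Prod.mk.inj h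
      exact ⟨mem_known_record.2 (Or.inr ⟨rfl, b, hb, rfl⟩), mem_known_record.2 (Or.inl hb), ht b hb⟩
    · rintro _ ⟨b, hb, rfl⟩
      exact ⟨(ht b hb).source_mem, _, b, hb, .bwd (mem_corr_record.2 (Or.inr ⟨rfl, b, hb, rfl⟩))⟩

theorem sound_of_run {P : Set (ParamPoly m n)} {F : SquareSystem m n}
    (hF : F.LocallyDefines (solutionVariety P)) {c : TrackConstants} {s : CompState n V E}
    (hx₀ : x₀ ∈ fiber (solutionVariety P) (G.pos z₀))
    (hs : Relation.ReflTransGen (Step c F G) (init z₀ x₀) s) :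
    s.Sound (solutionVariety P) G z₀ x₀ := by
  induction hs with
  | refl => exact sound_init hx₀
  | tail _ hstep ih => exact hstep.sound hF ih

/-- At a saturated graph the recorded pairs form bijections. -/
theorem Sound.exists_equiv {s : CompState n V E} (h : s.Sound X G z₀ x₀) (hsat : s.Saturated G) :
    ∃ γ : ∀ e, s.known (G.src e) ≃ s.known (G.tgt e), ∀ e a b, (a, b) ∈ s.corr e ↔
      ∃ ha : a ∈ s.known (G.src e), (γ e ⟨a, ha⟩ : CVec n) = b := by
  -- Saturation at the source provides the map. Uniqueness of targets makes it independent of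
  -- choices, uniqueness of sources makes it injective, and saturation at the target makes it
  -- surjective.
  choose f hfmem hfcorr using fun e => (hsat e).1
  have huniq : ∀ e a ha b, (a, b) ∈ s.corr e → f e a ha = b := fun e a ha b hab =>
    (h.corr_mem _ _ _ (hfcorr e a ha)).2.2.target_unique (h.corr_mem _ _ _ hab).2.2
  refine ⟨fun e => Equiv.ofBijective (fun a => ⟨f e a a.2, hfmem e a a.2⟩) ⟨?_, ?_⟩, ?_⟩
  · intro a a' haa'
    have h1 := (h.corr_mem _ _ _ (hfcorr e a a.2)).2.2
    rw [show f e a a.2 = f e a' a'.2 from congrArg Subtype.val haa'] at h1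
    exact Subtype.ext (h1.source_unique (h.corr_mem _ _ _ (hfcorr e a' a'.2)).2.2)
  · rintro ⟨b, hb⟩
    obtain ⟨a, ha, hab⟩ := (hsat e).2 b hb
    exact ⟨⟨a, ha⟩, Subtype.ext (huniq e a ha b hab)⟩
  · intro e a b
    refine ⟨fun hab => ⟨(h.corr_mem _ _ _ hab).1, huniq e a _ b hab⟩, ?_⟩
    rintro ⟨ha, rfl⟩
    exact hfcorr e a ha

/-- Every known solution is the transport of `x₀` along a walk. -/
theorem Sound.exists_walk {s : CompState n V E} (h : s.Sound X G z₀ x₀)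
    {γ : ∀ e, s.known (G.src e) ≃ s.known (G.tgt e)}
    (hγ : ∀ e a b, (a, b) ∈ s.corr e ↔ ∃ ha : a ∈ s.known (G.src e), (γ e ⟨a, ha⟩ : CVec n) = b)
    {v : V} (a : s.known v) : ∃ W : G.Walk z₀ v, W.transport γ ⟨x₀, h.base_mem⟩ = a := by
  suffices H : ∀ q, Relation.ReflTransGen (s.Recorded G) (z₀, x₀) q →
      ∃ W : G.Walk z₀ q.1, (W.transport γ ⟨x₀, h.base_mem⟩ : CVec n) = q.2 by
    obtain ⟨W, hW⟩ := H _ (h.reached v a a.2)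
    exact ⟨W, Subtype.ext hW⟩
  intro q hq
  induction hq with
  | refl => exact ⟨.nil z₀, rfl⟩
  | tail _ hrec ih =>
    obtain ⟨W, hW⟩ := ih
    cases hrec with
    | @fwd e a b hab =>
      obtain ⟨ha, rfl⟩ := (hγ e a b).1 hab
      refine ⟨W.append (.fwd e (.nil _)), ?_⟩
      have : W.transport γ ⟨x₀, h.base_mem⟩ = ⟨a, ha⟩ := Subtype.ext hW
      simp [HomotopyGraph.Walk.transport_append, HomotopyGraph.Walk.transport, this]
    | @bwd e a b hab =>
      obtain ⟨ha, rfl⟩ := (hγ e a b).1 hab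
      refine ⟨W.append (.bwd e (.nil _)), ?_⟩
      have : W.transport γ ⟨x₀, h.base_mem⟩ = γ e ⟨a, ha⟩ := Subtype.ext hW
      simp [HomotopyGraph.Walk.transport_append, HomotopyGraph.Walk.transport, this]

end CompState

end CertMon

/-! ### The main theorem -/

theorem mainTheorem1 {m n d : ℕ} {V E : Type*} [Finite V] [Finite E]
    (P : Set (CertMon.ParamPoly m n)) (X : Set (CertMon.CVec m × CertMon.CVec n))
    (hX : X = CertMon.solutionVariety P)
    (hd : CertMon.IsGenericRootCount X d)
    (F : CertMon.SquareSystem m n) (hF : F.LocallyDefines X)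
    (G : CertMon.HomotopyGraph m V E) (hconn : G.Connected) (hG : G.AvoidsDiscriminant X d)
    (z₀ : V) (x₀ : CertMon.CVec n) (hx₀ : x₀ ∈ CertMon.fiber X (G.pos z₀))
    (c : CertMon.TrackConstants)
    (s : CertMon.CompState n V E) (hs : CertMon.CertifiedMonodromyRun c F G z₀ x₀ s) :
    -- all known solutions lie in the fibers, and the recorded correspondences are bijections `γ e`
    (∀ v, s.known v ⊆ CertMon.fiber X (G.pos v)) ∧
    ∃ γ : ∀ e, s.known (G.src e) ≃ s.known (G.tgt e),
      (∀ e a b, (a, b) ∈ s.corr e ↔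
        ∃ ha : a ∈ s.known (G.src e), (γ e ⟨a, ha⟩ : CertMon.CVec n) = b) ∧
      -- each closed walk induces a permutation of the known solutions at the base vertex
      (∀ W : G.Walk z₀ z₀, ∃ σ : Equiv.Perm (s.known z₀), CertMon.Induces X W.toPath σ) ∧
      -- the output `S`, for any choice of a spanning tree
      ∀ T : Set E, G.IsSpanningTree T →
        ∀ S : Set (Equiv.Perm (s.known z₀)), S = G.monodromyGenerators γ z₀ T →
          -- `S` consists of permutations induced by loops that avoid the discriminant
          (∀ σ ∈ S, ∃ ℓ : Path (G.pos z₀) (G.pos z₀),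
            (∀ t, ℓ t ∉ CertMon.discriminant X d) ∧ CertMon.Induces X ℓ σ) ∧
          -- the transitive action of `⟨S⟩` on the known solutions is that of `Mon_{G,z₀}`
          MulAction.IsPretransitive (Subgroup.closure S) (s.known z₀) ∧
          Subgroup.closure S = CertMon.graphMonodromyGroup X G z₀ (s.known z₀) ∧
          -- if `k = d`, then `⟨S⟩ = Mon_{G,z₀} ⊆ Mon_π` as permutation groups of the fiber
          ((s.known z₀).encard = d →
            ∃ h : s.known z₀ = CertMon.fiber X (G.pos z₀),
              (Subgroup.closure S).map
                  (Equiv.permCongrHom (Equiv.setCongr h)).toMonoidHom =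
                CertMon.graphMonodromyGroup X G z₀ (CertMon.fiber X (G.pos z₀)) ∧
              CertMon.graphMonodromyGroup X G z₀ (CertMon.fiber X (G.pos z₀)) ≤
                CertMon.monodromyGroup X d (G.pos z₀)) := by 
  subst hX
  have hsound := CertMon.CompState.sound_of_run hF hx₀ hs.1
  have hK := hsound.known_subset
  obtain ⟨γ, hγ⟩ := hsound.exists_equiv hs.2
  have hγt : ∀ e (a : s.known (G.src e)),
      CertMon.Transports (CertMon.solutionVariety P) (G.path e) a (γ e a) :=
    fun e a => (hsound.corr_mem e a (γ e a) ((hγ e a _).2 ⟨a.2, rfl⟩)).2.2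
  refine ⟨hK, γ, hγ, fun W => ⟨_, W.induces_transport hG hK hγt⟩, ?_⟩
  rintro T hT S rfl
  have hcl := CertMon.HomotopyGraph.closure_monodromyGenerators hG hK hγt (z₀ := z₀) hT
  refine ⟨fun σ hσ => ?_, ⟨fun a b => ?_⟩, hcl, fun hk => ?_⟩
  · obtain ⟨W, rfl⟩ := CertMon.HomotopyGraph.exists_walk_of_mem_monodromyGenerators hσ
    exact ⟨W.toPath, hG.toPath_notMem W, W.induces_transport hG hK hγt⟩
  -- Transitivity: with `W₁` and `W₂` leading from `x₀` to `a` and `b`, the closed walk `W₁⁻¹ W₂`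
  -- carries `a` through `x₀` to `b`.
  · obtain ⟨W₁, h₁⟩ := hsound.exists_walk hγ a
    obtain ⟨W₂, h₂⟩ := hsound.exists_walk hγ b
    refine ⟨⟨_, hT.transport_mem_closure γ (W₁.reverse.append W₂)⟩, ?_⟩
    change (W₁.reverse.append W₂).transport γ a = b
    rw [CertMon.HomotopyGraph.Walk.transport_append, CertMon.HomotopyGraph.Walk.transport_reverse,
      Equiv.trans_apply, ← h₁, Equiv.symm_apply_apply, h₂]
  · have hfib : (CertMon.fiber (CertMon.solutionVariety P) (G.pos z₀)).encard = d :=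
      not_not.1 (hG.1 z₀)
    -- The base vertex is off the discriminant, so the fiber has `d` points and a subset with `d`
    -- points is all of it.
    have h := (Set.finite_of_encard_eq_coe hk).eq_of_subset_of_encard_le (hK z₀)
      (by rw [hfib, hk])
    refine ⟨h, ?_, CertMon.graphMonodromyGroup_le hG z₀⟩
    rw [hcl]
    exact CertMon.map_permCongrHom_graphMonodromyGroup _ G z₀ h
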